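/- Every tree on at least three vertices is reconstructible from its deck (Kelly's theorem). Precisely: all graphs are finite, simple and undirected. For a vertex $v$ of a graph $G$, the card of $G$ at $v$ is the graph $G - v$ obtained by deleting $v$ and all edges incident with it. The deck of $G$ is the multiset of the isomorphism classes of the cards $G - v$, one for each vertex $v$ of $G$. Let $T$ be a tree with at least three vertices, and let $H$ be any finite simple graph (not assumed to be a tree) whose deck equals the deck of $T$. Then $H$ is isomorphic to $T$. -/

import Mathlib

namespace GraphReconstruction

universe u

/-- Isomorphism, as an equivalence relation on all simple graphs. -/
def isoSetoid : Setoid (Σ V : Type u, SimpleGraph V) where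
  r G H := Nonempty (G.2 ≃g H.2)
  iseqv :=
    { refl := fun _ => ⟨SimpleGraph.Iso.refl⟩
      symm := fun ⟨e⟩ => ⟨e.symm⟩
      trans := fun ⟨e⟩ ⟨f⟩ => ⟨f.comp e⟩ }

/-- Isomorphism classes of simple graphs. -/
def IsoClass : Type (u + 1) := Quotient isoSetoid.{u}

/-- The isomorphism class of a graph. -/
def isoClass {V : Type u} (G : SimpleGraph V) : IsoClass.{u} :=
  Quotient.mk isoSetoid ⟨V, G⟩

/-- The card of `G` at `v`: the graph obtained from `G` by deleting the vertex `v`. -/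
def card {V : Type u} (G : SimpleGraph V) (v : V) : SimpleGraph ({v}ᶜ : Set V) :=
  G.induce {v}ᶜ

/-- The deck of a finite graph: the multiset of the isomorphism classes of its cards, with one
entry for each vertex. -/
def deck {V : Type u} [Fintype V] (G : SimpleGraph V) : Multiset IsoClass.{u} :=
  (Finset.univ : Finset V).val.map fun v => isoClass (card G v)

/-- A finite graph is reconstructible if its deck determines it up to isomorphism among all
finite graphs. -/
def Reconstructible {V : Type u} [Fintype V] (G : SimpleGraph V) : Prop :=
  ∀ (W : Type u) [Fintype W] (H : SimpleGraph W), deck H = deck G → Nonempty (H ≃g G)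

end GraphReconstruction

/-!
A tree is recovered from the cards at its leaves, with a centroid (a vertex all of whose branches
have at most half of the vertices) as the root.

*Passage to rooted trees.* `UTree` is the type of finite rooted trees up to isomorphism, realized as
plane trees modulo the order of the branches; it is in bijection with `Multiset UTree` by taking the
branches at the root. A graph with the deck of a tree `T` is a tree, since its edges can be counted
on the cards and two connected cards force connectedness, and corresponding vertices have equal
degrees. Rooting both trees at a centroid, which is not a leaf, the connected cards are the graphs
of the rooted trees listed by `UTree.del`, the multiset of leaf-deleted subtrees. The deck shows
these without their roots, that is up to moving the root along edges (`UTree.free`). Two centroids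
of a tree coincide or are the ends of an edge that halves it (`UTree.Centroid.eq_or_of_free_eq`), so
in most cards the original root can be found again.

*Rooted reconstruction* (`UTree.eq_of_del`). A rooted tree is determined by its size, its number of
leaves and the set of its leaf-deleted subtrees. A single branch at the root is treated by
induction. With several branches, a largest branch `L` is visible in some subtree, its multiplicity
is seen from the subtrees with fewest copies of `L`, and these arise by replacing one copy of `L` by
a leaf-deleted subtree of `L`.

*Odd number of vertices* (`UTree.eq_of_odd`). With `2 * m + 1` vertices, the root stays a centroid
of every card. It is the only one unless the card has a branch with `m` vertices. According to
whether the tree has no, one or two such branches, the rooted cards are known, or the cards with one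
centroid show the part outside the large branch, or each card is an unordered pair of halves.

*Even number of vertices* (`UTree.free_eq_of_even`). With `2 * m` vertices, each card has a unique
centroid. It is the root unless the tree has two centroids, joined by an edge with sides `A` and
`B`; then the cards consist of `A` with a leaf-deleted subtree of `B` as an additional branch, or
vice versa. The resulting problems on unordered pairs of trees are solved by
`UTree.pair_eq_of_pairCards`, which applies as soon as the two members of a pair can be told apart,
and by `UTree.pair_eq_of_plantPair`, which strips common stems until they can.
-/

/-! ### Unordered rooted trees -/

/-- Plane rooted trees: `leaf` is the one-vertex tree, and `graft s t` is obtained from `s` by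
making the root of `t` a new child of the root of `s`. -/
inductive PlaneTree : Type
  | leaf : PlaneTree
  | graft (s t : PlaneTree) : PlaneTree

/-- One exchange of two branches that are neighbours in the plane order, at any vertex. -/
inductive PlaneTree.Rel : PlaneTree → PlaneTree → Prop
  | swap (a b c) : Rel (graft (graft a b) c) (graft (graft a c) b)
  | left {s s'} (t) : Rel s s' → Rel (graft s t) (graft s' t)
  | right (s) {t t'} : Rel t t' → Rel (graft s t) (graft s t')

/-- Finite rooted trees up to isomorphism: plane trees modulo the order of the branches. -/
def UTree : Type := Quot PlaneTree.Rel

namespace UTree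

/-- The isomorphism class of a plane tree. -/
def mk (p : PlaneTree) : UTree := Quot.mk _ p

/-- The one-vertex rooted tree. -/
def leaf : UTree := mk .leaf

/-- `graft s t` adds the tree `t` as a further branch at the root of `s`. -/
def graft : UTree → UTree → UTree :=
  Quot.map₂ PlaneTree.graft (fun s _ _ h => .right s h) (fun _ _ t h => .left t h)

@[simp] lemma mk_leaf : mk .leaf = leaf := rfl

@[simp] lemma mk_graft (s t : PlaneTree) : mk (.graft s t) = graft (mk s) (mk t) := rfl

lemma exists_mk (x : UTree) : ∃ p, mk p = x := Quot.exists_rep x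

@[elab_as_elim]
lemma graft_induction {P : UTree → Prop} (hl : P leaf)
    (hg : ∀ s t, P s → P t → P (graft s t)) (x : UTree) : P x := by
  obtain ⟨p, rfl⟩ := exists_mk x
  induction p with
  | leaf => exact hl
  | graft s t hs ht => exact hg _ _ hs ht

lemma graft_right_comm (a b c : UTree) : graft (graft a b) c = graft (graft a c) b := by
  obtain ⟨a, rfl⟩ := exists_mk a
  obtain ⟨b, rfl⟩ := exists_mk b
  obtain ⟨c, rfl⟩ := exists_mk c
  exact Quot.sound (.swap a b c)

/-- The number of vertices. -/
noncomputable def size : UTree → ℕ :=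
  Quot.lift (fun p => p.rec 1 fun _ _ a b => a + b) <| by
    intro p q h
    induction h with
    | swap a b c => exact Nat.add_right_comm _ _ _
    | left t _ ih => exact congrArg (· + _) ih
    | right s _ ih => exact congrArg (_ + ·) ih

@[simp] lemma size_leaf : size leaf = 1 := rfl

@[simp] lemma size_graft (s t : UTree) : size (graft s t) = size s + size t := by
  obtain ⟨s, rfl⟩ := exists_mk s
  obtain ⟨t, rfl⟩ := exists_mk t
  rfl

/-- The branches at the root. -/
noncomputable def children : UTree → Multiset UTree :=
  Quot.lift (fun p => p.rec 0 fun _ t a _ => mk t ::ₘ a) <| by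
    intro p q h
    induction h with
    | swap a b c => exact Multiset.cons_swap _ _ _
    | left t _ ih => exact congrArg (_ ::ₘ ·) ih
    | @right s t t' h _ => exact congrArg (· ::ₘ _) (Quot.sound h : mk t = mk t')

@[simp] lemma children_leaf : children leaf = 0 := rfl

@[simp] lemma children_graft (s t : UTree) : children (graft s t) = t ::ₘ children s := by
  obtain ⟨s, rfl⟩ := exists_mk s
  obtain ⟨t, rfl⟩ := exists_mk t
  rfl

instance : LeftCommutative fun t x : UTree => graft x t := ⟨fun _ _ _ => graft_right_comm _ _ _⟩

/-- The rooted tree with the given branches at its root. -/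
def node (F : Multiset UTree) : UTree := F.foldr (fun t x => graft x t) leaf

@[simp] lemma node_zero : node 0 = leaf := rfl

@[simp] lemma node_cons (t : UTree) (F : Multiset UTree) : node (t ::ₘ F) = graft (node F) t := by
  simp [node]

@[simp] lemma children_node (F : Multiset UTree) : children (node F) = F := by
  induction F using Multiset.induction with
  | empty => rfl
  | cons t F ih => simp [ih]

@[simp] lemma node_children (x : UTree) : node (children x) = x := by
  induction x using graft_induction with
  | hl => rfl
  | hg s t hs _ => simp [hs]

lemma exists_node (x : UTree) : ∃ F, x = node F := ⟨_, (node_children x).symm⟩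

lemma node_injective : Function.Injective node := fun F F' h => by
  simpa using congrArg children h

@[simp] lemma node_inj {F F' : Multiset UTree} : node F = node F' ↔ F = F' :=
  node_injective.eq_iff

lemma children_injective : Function.Injective children := fun x y h => by
  simpa using congrArg node h

lemma size_node (F : Multiset UTree) : size (node F) = (F.map size).sum + 1 := by
  induction F using Multiset.induction with
  | empty => rfl
  | cons t F ih => simp [ih]; ring

lemma size_pos (x : UTree) : 0 < size x := by
  obtain ⟨F, rfl⟩ := exists_node x
  rw [size_node]; omega

lemma graft_right_inj {s t t' : UTree} : graft s t = graft s t' ↔ t = t' :=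
  ⟨fun h => by simpa using congrArg children h, fun h => by rw [h]⟩

lemma graft_ne_leaf (s t : UTree) : graft s t ≠ leaf := fun h => by
  simpa using congrArg children h

lemma size_eq_one_iff {x : UTree} : size x = 1 ↔ x = leaf := by
  refine ⟨fun h => ?_, fun h => by simp [h]⟩
  induction x using graft_induction with
  | hl => rfl
  | hg s t _ _ =>
    have := size_pos s
    have := size_pos t
    simp at h; omega

/-- A grafting read in two ways: either the two last branches agree, or each of them is a branch
of the other remainder. -/
lemma graft_eq_graft {s t s' t' : UTree} (h : graft s t = graft s' t') :
    (s = s' ∧ t = t') ∨ ∃ u, s = graft u t' ∧ s' = graft u t := by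
  have h' := congrArg children h
  simp only [children_graft, Multiset.cons_eq_cons] at h'
  rcases h' with ⟨h1, h2⟩ | ⟨_, F, h1, h2⟩
  · exact .inl ⟨children_injective h2, h1⟩
  · exact .inr ⟨node F, children_injective (by simp [h1]), children_injective (by simp [h2])⟩

/-! ### Deleting a leaf other than the root -/

open Classical in
/-- The multiset of the rooted trees obtained by deleting a leaf other than the root, one entry for
each such leaf. -/
noncomputable def del : UTree → Multiset UTree :=
  Quot.lift (fun p => p.rec (motive := fun _ => Multiset UTree) 0 fun s t a b =>
    a.map (graft · (mk t)) + if mk t = leaf then {mk s} else b.map (graft (mk s))) <| by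
    intro p q h
    induction h with
    | swap a b c =>
      simp only [mk_graft, Multiset.map_add, Multiset.map_map, Function.comp_def,
        graft_right_comm _ (mk b) (mk c), add_assoc]
      congr 1
      rw [add_comm]
      split_ifs with h1 h2 h2
      · simp [h1, h2]
      · simp [h1, Multiset.map_map, graft_right_comm _ leaf]
      · simp [h2, Multiset.map_map, graft_right_comm _ leaf]
      · simp [Multiset.map_map, graft_right_comm _ _ (mk c), graft_right_comm _ (mk b)]
    | @left s s' t h ih =>
      have : mk s = mk s' := Quot.sound h
      simp only [this]
      exact congrArg (fun x => Multiset.map _ x + _) ih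
    | @right s t t' h ih =>
      have : mk t = mk t' := Quot.sound h
      simp only [this]
      split_ifs
      · rfl
      · exact congrArg (fun x => _ + Multiset.map _ x) ih

@[simp] lemma del_leaf : del leaf = 0 := rfl

open Classical in
lemma del_graft (s t : UTree) : del (graft s t) =
    (del s).map (graft · t) + if t = leaf then {s} else (del t).map (graft s) := by
  obtain ⟨s, rfl⟩ := exists_mk s
  obtain ⟨t, rfl⟩ := exists_mk t
  rfl

lemma del_graft_leaf (s : UTree) : del (graft s leaf) = (del s).map (graft · leaf) + {s} := by
  simp [del_graft]

lemma del_graft_of_ne (s : UTree) {t : UTree} (ht : t ≠ leaf) :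
    del (graft s t) = (del s).map (graft · t) + (del t).map (graft s) := by
  simp [del_graft, ht]

lemma mem_del_graft_left {s z : UTree} (t : UTree) (hz : z ∈ del s) :
    graft z t ∈ del (graft s t) := by
  classical
  rw [del_graft]
  exact Multiset.mem_add.2 (.inl (Multiset.mem_map_of_mem _ hz))

lemma mem_del_graft_right (s : UTree) {t z : UTree} (hz : z ∈ del t) :
    graft s z ∈ del (graft s t) := by
  have : t ≠ leaf := by rintro rfl; simp at hz
  rw [del_graft_of_ne _ this]
  exact Multiset.mem_add.2 (.inr (Multiset.mem_map_of_mem _ hz))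

lemma mem_del_node {F : Multiset UTree} {z : UTree} : z ∈ del (node F) ↔
    ∃ t F₀, F = t ::ₘ F₀ ∧ ((t = leaf ∧ z = node F₀) ∨ ∃ t' ∈ del t, z = node (t' ::ₘ F₀)) := by
  classical
  constructor
  · induction F using Multiset.induction generalizing z with
    | empty => simp
    | cons t F ih =>
      intro hz
      rw [node_cons, del_graft, Multiset.mem_add, Multiset.mem_map] at hz
      rcases hz with ⟨w, hw, rfl⟩ | hz
      · obtain ⟨u, F₀, rfl, h⟩ := ih hw
        refine ⟨u, t ::ₘ F₀, Multiset.cons_swap _ _ _, ?_⟩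
        rcases h with ⟨h, rfl⟩ | ⟨u', hu, rfl⟩
        · exact .inl ⟨h, by simp⟩
        · exact .inr ⟨u', hu, by simp [graft_right_comm]⟩
      · refine ⟨t, F, rfl, ?_⟩
        split_ifs at hz with h
        · exact .inl ⟨h, by simpa using hz⟩
        · obtain ⟨t', ht', rfl⟩ := Multiset.mem_map.1 hz
          exact .inr ⟨t', ht', by simp⟩
  · rintro ⟨t, F₀, rfl, h⟩
    rw [node_cons, del_graft, Multiset.mem_add]
    right
    rcases h with ⟨rfl, rfl⟩ | ⟨t', ht', rfl⟩
    · simp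
    · have : t ≠ leaf := by rintro rfl; simp at ht'
      rw [if_neg this]
      exact Multiset.mem_map.2 ⟨t', ht', by simp⟩

lemma size_of_mem_del {x z : UTree} (h : z ∈ del x) : size z + 1 = size x := by
  classical
  induction x using graft_induction generalizing z with
  | hl => simp at h
  | hg s t hs ht =>
    rw [del_graft, Multiset.mem_add, Multiset.mem_map] at h
    rcases h with ⟨w, hw, rfl⟩ | h
    · have := hs hw
      simp; omega
    · split_ifs at h with h1
      · simp at h; simp [h, h1]
      · obtain ⟨w, hw, rfl⟩ := Multiset.mem_map.1 h
        have := ht hw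
        simp; omega

lemma del_ne_zero {x : UTree} (hx : x ≠ leaf) : del x ≠ 0 := by
  classical
  induction x using graft_induction with
  | hl => exact absurd rfl hx
  | hg s t _ ht =>
    rw [del_graft]
    split_ifs with h
    · simp
    · simp [ht h]

lemma exists_mem_del {x : UTree} (hx : x ≠ leaf) : ∃ z, z ∈ del x :=
  Multiset.exists_mem_of_ne_zero (del_ne_zero hx)

lemma card_children_le_card_del (x : UTree) : (children x).card ≤ (del x).card := by
  classical
  induction x using graft_induction with
  | hl => simp
  | hg s t hs _ =>
    rw [del_graft]
    have : 1 ≤ (if t = leaf then {s} else (del t).map (graft s)).card := by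
      split_ifs with h
      · simp
      · simpa [Nat.one_le_iff_ne_zero] using del_ne_zero h
    simp only [children_graft, Multiset.card_cons, Multiset.card_add, Multiset.card_map]
    omega

/-- The tree in which the root has the single branch `t`. -/
abbrev plant (t : UTree) : UTree := graft leaf t

lemma plant_eq_node (t : UTree) : plant t = node {t} := by
  simpa using (node_cons t 0).symm

lemma del_plant {t : UTree} (ht : t ≠ leaf) : del (plant t) = (del t).map plant := by
  simp [del_graft_of_ne _ ht]

lemma plant_injective : Function.Injective plant := fun _ _ h => graft_right_inj.1 h

lemma card_children_eq_one {x : UTree} : (children x).card = 1 ↔ ∃ t, x = plant t := by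
  constructor
  · intro h
    obtain ⟨t, ht⟩ := Multiset.card_eq_one.1 h
    exact ⟨t, children_injective (by simp [ht])⟩
  · rintro ⟨t, rfl⟩; simp

lemma eq_node_cons_of_mem {x t : UTree} (h : t ∈ children x) : ∃ F, x = node (t ::ₘ F) := by
  obtain ⟨F, hF⟩ := Multiset.exists_cons_of_mem h
  exact ⟨F, by rw [← hF, node_children]⟩

lemma eq_graft_of_mem {x t : UTree} (h : t ∈ children x) : ∃ s, x = graft s t := by
  obtain ⟨F, rfl⟩ := eq_node_cons_of_mem h
  exact ⟨node F, by simp⟩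

/-! ### Rooted trees are determined by their leaf-deleted subtrees -/

lemma mem_del_cons_leaf (F : Multiset UTree) : node F ∈ del (node (leaf ::ₘ F)) :=
  mem_del_node.2 ⟨leaf, F, rfl, .inl ⟨rfl, rfl⟩⟩

lemma mem_del_cons {t t' : UTree} (h : t' ∈ del t) (F : Multiset UTree) :
    node (t' ::ₘ F) ∈ del (node (t ::ₘ F)) :=
  mem_del_node.2 ⟨t, F, rfl, .inr ⟨t', h, rfl⟩⟩

/-- Some leaf-deletion inside the branch `t` keeps all other branches. -/
lemma exists_mem_del_cons (t : UTree) (F : Multiset UTree) :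
    ∃ M, node M ∈ del (node (t ::ₘ F)) ∧ F ≤ M := by
  by_cases h : t = leaf
  · exact ⟨F, h ▸ mem_del_cons_leaf F, le_rfl⟩
  · obtain ⟨t', ht'⟩ := exists_mem_del h
    exact ⟨t' ::ₘ F, mem_del_cons ht' F, Multiset.le_cons_self _ _⟩

/-- A leaf-deletion creates no branch of maximal size. -/
lemma mem_of_mem_of_mem_del {L : UTree} {F M : Multiset UTree} (hmax : ∀ t ∈ F, size t ≤ size L)
    (hM : node M ∈ del (node F)) (hL : L ∈ M) : L ∈ F := by
  obtain ⟨t, F₀, rfl, h⟩ := mem_del_node.1 hM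
  rcases h with ⟨-, h⟩ | ⟨t', ht', h⟩ <;> rw [node_inj] at h <;> subst h
  · exact Multiset.mem_cons_of_mem hL
  · rcases Multiset.mem_cons.1 hL with rfl | h
    · have := size_of_mem_del ht'
      have := hmax t (by simp)
      omega
    · exact Multiset.mem_cons_of_mem h

open Classical in
lemma count_le_count_of_mem_del {F M : Multiset UTree} (L : UTree)
    (hM : node M ∈ del (node F)) : F.count L ≤ M.count L + 1 := by
  obtain ⟨t, F₀, rfl, h⟩ := mem_del_node.1 hM
  rw [Multiset.count_cons]
  rcases h with ⟨-, h⟩ | ⟨t', ht', h⟩ <;> rw [node_inj] at h <;> subst h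
  · split_ifs <;> omega
  · rw [Multiset.count_cons]; split_ifs <;> omega

lemma ne_of_mem_del {t t' : UTree} (h : t' ∈ del t) : t ≠ t' := by
  rintro rfl
  have := size_of_mem_del h
  omega

/-- If `L` is a common branch of two rooted trees with the same leaf-deleted subtrees, then these
trees coincide. The multiplicity of `L` is the same in both, and the deletions that decrease it are
those inside `L`; so replacing `L` by a fixed `t'` in one tree amounts to replacing it by some `u`
in the other and vice versa, and comparing the multiplicities of `t'` shows that `u = t'`. -/
lemma cons_eq_cons_of_del {L : UTree} {F F' : Multiset UTree} (hL : L ≠ leaf)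
    (hd : ∀ z, z ∈ del (node (L ::ₘ F)) ↔ z ∈ del (node (L ::ₘ F'))) : F = F' := by
  classical
  have key : ∀ {F F' : Multiset UTree},
      (∀ z, z ∈ del (node (L ::ₘ F)) → z ∈ del (node (L ::ₘ F'))) → F'.count L ≤ F.count L := by
    intro F F' hd
    obtain ⟨t', ht'⟩ := exists_mem_del hL
    have := count_le_count_of_mem_del L (hd _ (mem_del_cons ht' F))
    rw [Multiset.count_cons_self, Multiset.count_cons_of_ne (ne_of_mem_del ht')] at this
    omega
  have hcount : F.count L = F'.count L :=
    le_antisymm (key fun z => (hd z).2) (key fun z => (hd z).1)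
  have step : ∀ {F F' : Multiset UTree}, F.count L = F'.count L →
      (∀ z, z ∈ del (node (L ::ₘ F)) → z ∈ del (node (L ::ₘ F'))) →
      ∀ t' ∈ del L, ∃ t'', t' ::ₘ F = t'' ::ₘ F' := by
    intro F F' hc hd t' ht'
    obtain ⟨t, F₀, h1, h⟩ := mem_del_node.1 (hd _ (mem_del_cons ht' F))
    rcases Multiset.cons_eq_cons.1 h1 with ⟨rfl, rfl⟩ | ⟨hne, G, rfl, rfl⟩
    · rcases h with ⟨h, -⟩ | ⟨t'', -, h⟩
      · exact absurd h hL
      · exact ⟨t'', node_injective h⟩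
    · exfalso
      rw [Multiset.count_cons_of_ne hne] at hc
      rcases h with ⟨-, h⟩ | ⟨t'', -, h⟩ <;>
        have h := congrArg (Multiset.count L) (node_injective h)
      · rw [Multiset.count_cons_self, Multiset.count_cons_of_ne (ne_of_mem_del ht')] at h
        omega
      · rw [Multiset.count_cons_of_ne (ne_of_mem_del ht'), Multiset.count_cons,
          Multiset.count_cons_self] at h
        omega
  obtain ⟨t', ht'⟩ := exists_mem_del hL
  obtain ⟨u, hu⟩ := step hcount (fun z => (hd z).1) t' ht'
  obtain ⟨v, hv⟩ := step hcount.symm (fun z => (hd z).2) t' ht'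
  by_cases h1 : t' = u
  · subst h1; simpa using hu
  by_cases h2 : t' = v
  · subst h2; simpa using hv.symm
  have hu := congrArg (Multiset.count t') hu
  have hv := congrArg (Multiset.count t') hv
  rw [Multiset.count_cons_self, Multiset.count_cons_of_ne ‹_›] at hu hv
  omega

/-- Rooted trees with at least two branches are determined by the set of their leaf-deleted
subtrees. -/
lemma eq_of_del_of_two_le {F F' : Multiset UTree} (h2 : 2 ≤ F.card) (h2' : 2 ≤ F'.card)
    (hs : size (node F) = size (node F')) (hd : ∀ z, z ∈ del (node F) ↔ z ∈ del (node F')) :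
    F = F' := by
  classical
  obtain ⟨L, hL, hmax⟩ : ∃ L ∈ F + F', ∀ t ∈ F + F', size t ≤ size L := by
    have hne : (F + F').toFinset.Nonempty := by
      rw [Multiset.toFinset_nonempty]
      intro h
      have := congrArg Multiset.card h
      simp at this
      simp [this.1] at h2
    obtain ⟨L, hL, h⟩ := Finset.exists_max_image _ size hne
    exact ⟨L, by simpa using hL, fun t ht => h t (by simpa using ht)⟩
  wlog hLF : L ∈ F generalizing F F'
  · refine (this h2' h2 hs.symm (fun z => (hd z).symm) (by rwa [add_comm])
      (by rwa [add_comm]) ?_).symm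
    exact (Multiset.mem_add.1 hL).resolve_left hLF
  have hmaxF : ∀ t ∈ F, size t ≤ size L := fun t ht => hmax t (by simp [ht])
  have hmaxF' : ∀ t ∈ F', size t ≤ size L := fun t ht => hmax t (by simp [ht])
  by_cases hleaf : L = leaf
  · subst hleaf
    have all : ∀ G : Multiset UTree, (∀ t ∈ G, size t ≤ size leaf) →
        G = Multiset.replicate G.card leaf := by
      intro G hG
      refine Multiset.eq_replicate_card.2 fun t ht => size_eq_one_iff.1 ?_
      have := hG t ht
      have := size_pos t
      simp at *; omega
    have e := all F hmaxF
    have e' := all F' hmaxF'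
    have hc : F.card = F'.card := by
      rw [e, e'] at hs
      simpa [size_node] using hs
    rw [e, e', hc]
  · obtain ⟨F, rfl⟩ := Multiset.exists_cons_of_mem hLF
    obtain ⟨K, hK⟩ : ∃ K, K ∈ F := Multiset.card_pos_iff_exists_mem.1 (by simp at h2; omega)
    have hLF' : L ∈ F' := by
      obtain ⟨F, rfl⟩ := Multiset.exists_cons_of_mem hK
      obtain ⟨M, hM, hle⟩ := exists_mem_del_cons K (L ::ₘ F)
      rw [Multiset.cons_swap, hd] at hM
      exact mem_of_mem_of_mem_del hmaxF' hM (Multiset.mem_of_le hle (by simp))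
    obtain ⟨F', rfl⟩ := Multiset.exists_cons_of_mem hLF'
    rw [cons_eq_cons_of_del hleaf hd]

lemma eq_plant_leaf_of_size {x : UTree} (h : size x = 2) : x = plant leaf := by
  induction x using graft_induction with
  | hl => simp at h
  | hg s t _ _ =>
    have := size_pos s
    have := size_pos t
    simp only [size_graft] at h
    rw [size_eq_one_iff.1 (show size s = 1 by omega), size_eq_one_iff.1 (show size t = 1 by omega)]

lemma card_eq_zero_or_one_or_two_le (F : Multiset UTree) :
    F = 0 ∨ (∃ t, F = {t}) ∨ 2 ≤ F.card := by
  rcases h : F.card with _ | _ | n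
  · exact .inl (Multiset.card_eq_zero.1 h)
  · exact .inr (.inl (Multiset.card_eq_one.1 h))
  · exact .inr (.inr (by omega))

/-- A tree with a single branch and a tree with several branches differ in the number of leaves or
in the set of leaf-deleted subtrees. -/
lemma not_del_eq_of_two_le {t : UTree} {F : Multiset UTree} (h2 : 2 ≤ F.card)
    (hc : (del (plant t)).card = (del (node F)).card)
    (hd : ∀ z, z ∈ del (plant t) ↔ z ∈ del (node F)) : False := by
  have hl := card_children_le_card_del (node F)
  rw [children_node] at hl
  by_cases ht : t = leaf
  · subst ht
    simp [del_graft_leaf] at hc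
    omega
  · have single : ∀ M, node M ∈ del (node F) → M.card = 1 := by
      intro M hM
      rw [← hd, del_plant ht] at hM
      obtain ⟨z, -, hz⟩ := Multiset.mem_map.1 hM
      have := congrArg (fun x => (children x).card) hz
      simpa using this.symm
    obtain ⟨K, hK⟩ : ∃ K, K ∈ F := Multiset.card_pos_iff_exists_mem.1 (by omega)
    -- a deletion inside a branch with a further vertex would leave at least two branches
    have leaves : ∀ K ∈ F, K = leaf ∧ F.card = 2 := by
      intro K hK
      obtain ⟨F, rfl⟩ := Multiset.exists_cons_of_mem hK
      by_cases h : K = leaf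
      · subst h
        have := single _ (mem_del_cons_leaf F)
        simp [this]
      · obtain ⟨K', hK'⟩ := exists_mem_del h
        have := single _ (mem_del_cons hK' F)
        simp at this h2
        simp [this] at h2
    have hF : F = {leaf, leaf} := by
      have := Multiset.eq_replicate.2 ⟨(leaves K hK).2, fun b hb => (leaves b hb).1⟩
      rw [this]; rfl
    obtain ⟨z, hz⟩ := exists_mem_del ht
    have h1 := (hd (plant z)).1 (by rw [del_plant ht]; exact Multiset.mem_map_of_mem _ hz)
    have h3 := size_of_mem_del h1
    have h4 := size_of_mem_del hz
    have h5 : size z = 1 := by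
      rw [hF] at h3; simp [size_node] at h3; omega
    have h6 : t = plant leaf := eq_plant_leaf_of_size (by omega)
    have h7 : (del (plant t)).card = 1 := by
      rw [h6, del_plant (graft_ne_leaf _ _)]; simp [del_graft]
    omega

/-- A rooted tree is determined by its number of vertices, its number of leaves and the set of its
leaf-deleted subtrees. -/
theorem eq_of_del {x x' : UTree} (hs : size x = size x') (hc : (del x).card = (del x').card)
    (hd : ∀ z, z ∈ del x ↔ z ∈ del x') : x = x' := by
  induction hn : size x using Nat.strong_induction_on generalizing x x' with
  | _ n ih =>
  obtain ⟨F, rfl⟩ := exists_node x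
  obtain ⟨F', rfl⟩ := exists_node x'
  rcases card_eq_zero_or_one_or_two_le F with rfl | ⟨t, rfl⟩ | h2
  · have : size (node F') = 1 := by simpa using hs.symm
    simpa using (size_eq_one_iff.1 this).symm
  · rcases card_eq_zero_or_one_or_two_le F' with rfl | ⟨t', rfl⟩ | h2'
    · have : size (node {t}) = 1 := by simpa using hs
      simpa using size_eq_one_iff.1 this
    · rw [← plant_eq_node, ← plant_eq_node] at *
      have hs' : size t = size t' := by simpa using hs
      by_cases ht : t = leaf
      · have : size t' = 1 := by simpa [ht] using hs'.symm
        rw [ht, size_eq_one_iff.1 this]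
      · have ht' : t' ≠ leaf := by
          rintro rfl
          exact ht (size_eq_one_iff.1 (by simpa using hs'))
        rw [del_plant ht, del_plant ht'] at *
        congr 1
        refine ih (size t) (by rw [← hn]; simp) hs' (by simpa using hc) (fun z => ?_) rfl
        have := hd (plant z)
        rwa [Multiset.mem_map_of_injective plant_injective,
          Multiset.mem_map_of_injective plant_injective] at this
    · rw [← plant_eq_node] at *
      exact (not_del_eq_of_two_le h2' hc hd).elim
  · rcases card_eq_zero_or_one_or_two_le F' with rfl | ⟨t', rfl⟩ | h2'
    · have : size (node F) = 1 := by simpa using hs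
      simpa using size_eq_one_iff.1 this
    · rw [← plant_eq_node] at *
      exact (not_del_eq_of_two_le h2 hc.symm fun z => (hd z).symm).elim
    · rw [eq_of_del_of_two_le h2 h2' hs hd]

/-! ### Reconstructing an unordered pair of rooted trees -/

/-- The values `f A b` and `f B a`, where `b` is a leaf-deleted subtree of `B` and `a` one of
`A`. -/
noncomputable def pairCards {X : Type*} (f : UTree → UTree → X) (A B : UTree) : Multiset X :=
  (del B).map (f A) + (del A).map (f B)

section pairCards

variable {X : Type*} {f : UTree → UTree → X}

lemma pairCards_comm (A B : UTree) : pairCards f A B = pairCards f B A := add_comm _ _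

lemma mem_pairCards {A B : UTree} {x : X} :
    x ∈ pairCards f A B ↔ (∃ b ∈ del B, f A b = x) ∨ ∃ a ∈ del A, f B a = x := by
  simp [pairCards]

lemma left_mem_pairCards (A : UTree) {B b : UTree} (hb : b ∈ del B) : f A b ∈ pairCards f A B :=
  mem_pairCards.2 (.inl ⟨b, hb, rfl⟩)

lemma right_mem_pairCards {A a : UTree} (B : UTree) (ha : a ∈ del A) : f B a ∈ pairCards f A B :=
  mem_pairCards.2 (.inr ⟨a, ha, rfl⟩)

lemma size_eq_of_mem_del {k : ℕ} {A a : UTree} (hA : size A = k) (h : a ∈ del A) :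
    size a + 1 = k := hA ▸ size_of_mem_del h

lemma ne_leaf_of_size {k : ℕ} {A : UTree} (hA : size A = k) (hk : 2 ≤ k) : A ≠ leaf := by
  rintro rfl
  simp at hA; omega

/-- Two trees `A`, `B` of the same size can be recovered from the values of `f`, provided that
`f A b` determines `A` and `b`. -/
theorem pair_eq_of_pairCards_of_left {k : ℕ} (hk : 2 ≤ k) {A B A' B' : UTree}
    (hf : ∀ b A' b', size A' = k → size b + 1 = k → size b' + 1 = k →
      f A b = f A' b' → A = A' ∧ b = b')
    (hA : size A = k) (hB : size B = k) (hA' : size A' = k) (hB' : size B' = k)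
    (hc : (pairCards f A B).card = (pairCards f A' B').card)
    (h : ∀ x, x ∈ pairCards f A B ↔ x ∈ pairCards f A' B') :
    (A = A' ∧ B = B') ∨ (A = B' ∧ B = A') := by
  obtain ⟨b₀, hb₀⟩ := exists_mem_del (ne_leaf_of_size hB hk)
  wlog hAA : A = A' generalizing A' B'
  · refine (this hB' hA' (by rw [hc, pairCards_comm]) (fun x => by rw [h, pairCards_comm])
      ?_).symm
    rcases mem_pairCards.1 ((h _).1 (left_mem_pairCards A hb₀)) with ⟨b', hb', e⟩ | ⟨a', ha', e⟩
    · exact absurd (hf _ _ _ hA' (size_eq_of_mem_del hB hb₀) (size_eq_of_mem_del hB' hb') e.symm).1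
        hAA
    · exact (hf _ _ _ hB' (size_eq_of_mem_del hB hb₀) (size_eq_of_mem_del hA' ha') e.symm).1
  subst hAA
  obtain ⟨a₀, ha₀⟩ := exists_mem_del (ne_leaf_of_size hA hk)
  by_cases h1 : A = B
  · subst h1
    refine .inl ⟨rfl, ?_⟩
    rcases mem_pairCards.1 ((h _).2 (right_mem_pairCards B' ha₀)) with ⟨b, hb, e⟩ | ⟨b, hb, e⟩ <;>
    exact (hf _ _ _ hB' (size_eq_of_mem_del hA hb) (size_eq_of_mem_del hA ha₀) e).1
  by_cases h2 : A = B'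
  · subst h2
    rcases mem_pairCards.1 ((h _).1 (right_mem_pairCards B ha₀)) with ⟨b, hb, e⟩ | ⟨b, hb, e⟩ <;>
    exact absurd (hf _ _ _ hB (size_eq_of_mem_del hA hb) (size_eq_of_mem_del hA ha₀) e).1 h1
  refine .inl ⟨rfl, eq_of_del (hB.trans hB'.symm) (by simpa [pairCards] using hc) fun b => ?_⟩
  constructor
  · intro hb
    have sb := size_eq_of_mem_del hB hb
    rcases mem_pairCards.1 ((h _).1 (left_mem_pairCards A hb)) with ⟨b', hb', e⟩ | ⟨a', ha', e⟩
    · rwa [(hf _ _ _ hA sb (size_eq_of_mem_del hB' hb') e.symm).2]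
    · exact absurd (hf _ _ _ hB' sb (size_eq_of_mem_del hA ha') e.symm).1 h2
  · intro hb
    have sb := size_eq_of_mem_del hB' hb
    rcases mem_pairCards.1 ((h _).2 (left_mem_pairCards A hb)) with ⟨b', hb', e⟩ | ⟨a', ha', e⟩
    · rwa [(hf _ _ _ hA sb (size_eq_of_mem_del hB hb') e.symm).2]
    · exact absurd (hf _ _ _ hB sb (size_eq_of_mem_del hA ha') e.symm).1 h1

/-- Two trees of the same size can be recovered from the values of `f`, provided that for one of
them, marked by the predicate `good`, the arguments of `f` can be read off from its value. -/
theorem pair_eq_of_pairCards {k : ℕ} (hk : 2 ≤ k) {good : UTree → Prop}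
    (hf : ∀ A b A' b', good A → size A = k → size A' = k → size b + 1 = k → size b' + 1 = k →
      f A b = f A' b' → A = A' ∧ b = b') {A B A' B' : UTree}
    (hA : size A = k) (hB : size B = k) (hA' : size A' = k) (hB' : size B' = k)
    (hc : (pairCards f A B).card = (pairCards f A' B').card)
    (h : ∀ x, x ∈ pairCards f A B ↔ x ∈ pairCards f A' B') (hg : good A ∨ good B) :
    (A = A' ∧ B = B') ∨ (A = B' ∧ B = A') := by
  rcases hg with hg | hg
  · exact pair_eq_of_pairCards_of_left hk (fun b A' b' => hf A b A' b' hg hA) hA hB hA' hB' hc h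
  · have := pair_eq_of_pairCards_of_left hk (fun b A' b' => hf B b A' b' hg hB) hB hA hA' hB'
      (by rwa [pairCards_comm]) (fun x => by rw [← h, pairCards_comm])
    tauto

end pairCards

/-- The unordered pair formed by a tree and a planted tree. -/
def plantPair (A b : UTree) : Sym2 UTree := s(A, plant b)

lemma pairCards_plant {A B : UTree} (hA : A ≠ leaf) (hB : B ≠ leaf) :
    pairCards plantPair (plant A) (plant B) =
      (pairCards plantPair A B).map (Sym2.map plant) := by
  simp [pairCards, del_plant hA, del_plant hB, plantPair, Multiset.map_map, Function.comp_def]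

lemma plantPair_inj {A b A' b' : UTree} (hA : (children A).card ≠ 1)
    (h : plantPair A b = plantPair A' b') : A = A' ∧ b = b' := by
  rcases Sym2.eq_iff.1 h with ⟨h1, h2⟩ | ⟨h1, h2⟩
  · exact ⟨h1, plant_injective h2⟩
  · exact absurd (card_children_eq_one.2 ⟨_, h1⟩) hA

/-- Two trees `A`, `B` of the same size are determined by the unordered pairs that consist of one
of them and of a leaf-deleted subtree of the other on a longer stem. -/
theorem pair_eq_of_plantPair {k : ℕ} {A B A' B' : UTree}
    (hA : size A = k) (hB : size B = k) (hA' : size A' = k) (hB' : size B' = k)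
    (hc : (pairCards plantPair A B).card = (pairCards plantPair A' B').card)
    (h : ∀ x, x ∈ pairCards plantPair A B ↔ x ∈ pairCards plantPair A' B') :
    (A = A' ∧ B = B') ∨ (A = B' ∧ B = A') := by
  have leaf_case : ∀ {x y : UTree}, size x = 1 → size y = 1 → x = y := fun hx hy => by
    rw [size_eq_one_iff.1 hx, size_eq_one_iff.1 hy]
  induction k using Nat.strong_induction_on generalizing A B A' B' with
  | _ k ih =>
  have := size_pos A
  rcases (by omega : k = 1 ∨ 2 ≤ k) with rfl | hk
  · exact .inl ⟨leaf_case hA hA', leaf_case hB hB'⟩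
  have hf : ∀ A b A' b', (children A).card ≠ 1 → size A = k → size A' = k → size b + 1 = k →
      size b' + 1 = k → plantPair A b = plantPair A' b' → A = A' ∧ b = b' :=
    fun A b A' b' hg _ _ _ _ e => plantPair_inj hg e
  by_cases hg : (children A).card ≠ 1 ∨ (children B).card ≠ 1
  · exact pair_eq_of_pairCards hk hf hA hB hA' hB' hc h hg
  by_cases hg' : (children A').card ≠ 1 ∨ (children B').card ≠ 1
  · have := pair_eq_of_pairCards hk hf hA' hB' hA hB hc.symm (fun x => (h x).symm) hg'
    rcases this with ⟨rfl, rfl⟩ | ⟨rfl, rfl⟩ <;> simp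
  simp only [ne_eq, not_or, not_not, card_children_eq_one] at hg hg'
  obtain ⟨⟨A, rfl⟩, B, rfl⟩ := hg
  obtain ⟨⟨A', rfl⟩, B', rfl⟩ := hg'
  simp only [size_graft, size_leaf] at hA hB hA' hB'
  rcases (by omega : k = 2 ∨ 3 ≤ k) with rfl | hk
  · rw [leaf_case (x := A) (y := A') (by omega) (by omega),
      leaf_case (x := B) (y := B') (by omega) (by omega)]
    simp
  · have ne : ∀ {x}, 1 + size x = k → x ≠ leaf := fun hx =>
      ne_leaf_of_size (k := k - 1) (by omega) (by omega)
    rw [pairCards_plant (ne hA) (ne hB), pairCards_plant (ne hA') (ne hB')] at *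
    have := ih (k - 1) (by omega) (A := A) (B := B) (A' := A') (B' := B')
      (by omega) (by omega) (by omega) (by omega) (by simpa using hc) (fun x => by
        have := h (Sym2.map plant x)
        rwa [Multiset.mem_map_of_injective (Sym2.map.injective plant_injective),
          Multiset.mem_map_of_injective (Sym2.map.injective plant_injective)] at this)
    rcases this with ⟨rfl, rfl⟩ | ⟨rfl, rfl⟩ <;> simp

/-! ### Moving the root -/

/-- Moving the root along an edge at the root. -/
def Step (x y : UTree) : Prop := ∃ s t, x = graft s t ∧ y = graft t s

/-- Finite trees without a distinguished root, up to isomorphism. -/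
def Free : Type := Quot Step

/-- Forgetting the root. -/
def free (x : UTree) : Free := Quot.mk _ x

lemma free_graft_comm (s t : UTree) : free (graft s t) = free (graft t s) :=
  Quot.sound ⟨s, t, rfl, rfl⟩

lemma mem_of_free_eq {S : Set UTree} (hS : ∀ x y, Step x y → x ∈ S → y ∈ S) {x y : UTree}
    (h : free x = free y) (hx : x ∈ S) : y ∈ S := by
  have : ∀ x y, Relation.EqvGen Step x y → (x ∈ S ↔ y ∈ S) := by
    intro x y h
    induction h with
    | rel x y h => exact ⟨hS x y h, hS y x (let ⟨s, t, h1, h2⟩ := h; ⟨t, s, h2, h1⟩)⟩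
    | refl x => rfl
    | symm x y _ ih => exact ih.symm
    | trans x y z _ _ ih ih' => exact ih.trans ih'
  exact (this x y (Quot.eqvGen_exact h)).1 hx

/-- The root is a centroid: no branch has more than half of the vertices. -/
def Centroid (x : UTree) : Prop := ∀ c ∈ children x, 2 * size c ≤ size x

/-- `Hang x w u`: moving the root of `x` away to another vertex yields `graft w u`, in which `u` is
the branch that contains the original root. -/
inductive Hang (x : UTree) : UTree → UTree → Prop
  | base (s t) : x = graft s t → Hang x t s
  | step (w v u) : Hang x (graft w v) u → Hang x v (graft w u)

lemma eq_or_hang_of_free_eq {x y : UTree} (h : free x = free y) :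
    y = x ∨ ∃ w u, Hang x w u ∧ y = graft w u := by
  refine mem_of_free_eq (S := {z | z = x ∨ ∃ w u, Hang x w u ∧ z = graft w u}) ?_ h (.inl rfl)
  rintro _ _ ⟨a, b, rfl, rfl⟩ (h | ⟨w, u, hh, e⟩)
  · exact .inr ⟨b, a, .base _ _ h.symm, rfl⟩
  · rcases graft_eq_graft e with ⟨rfl, rfl⟩ | ⟨c, rfl, rfl⟩
    · cases hh with
      | base s t hx => exact .inl hx.symm
      | step w v u hh => exact .inr ⟨_, _, hh, graft_right_comm _ _ _⟩
    · exact .inr ⟨_, _, .step _ _ _ hh, rfl⟩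

lemma Hang.size {x w u : UTree} (hx : Centroid x) (h : Hang x w u) :
    size w + size u = UTree.size x ∧ UTree.size x ≤ 2 * UTree.size u ∧
      (x = graft u w ∨ UTree.size x < 2 * UTree.size u) := by
  induction h with
  | base s t h =>
    have := hx t (by simp [h])
    simp only [h, size_graft] at this ⊢
    exact ⟨by omega, by omega, .inl trivial⟩
  | step w v u _ ih =>
    have := size_pos w
    simp only [size_graft] at ih ⊢
    exact ⟨by omega, by omega, .inr (by omega)⟩

/-- Two centroids of a tree are the same vertex, or they are joined by an edge that halves the
tree. -/
theorem Centroid.eq_or_of_free_eq {x y : UTree} (hx : Centroid x) (hy : Centroid y)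
    (h : free x = free y) :
    x = y ∨ ∃ s t, size s = size t ∧ x = graft s t ∧ y = graft t s := by
  rcases eq_or_hang_of_free_eq h with rfl | ⟨w, u, hh, rfl⟩
  · exact .inl rfl
  · obtain ⟨h1, h2, h3⟩ := hh.size hx
    have := hy u (by simp)
    simp only [size_graft] at this
    rcases h3 with h3 | h3
    · exact .inr ⟨u, w, by omega, h3, rfl⟩
    · omega

/-- Every tree has a centroid. -/
theorem exists_centroid (x : UTree) : ∃ y, Centroid y ∧ free y = free x := by
  have key : ∀ n s t, size t ≤ n → size s < size t →
      ∃ y, Centroid y ∧ free y = free (graft t s) := by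
    intro n
    induction n with
    | zero => intro s t h; have := size_pos t; omega
    | succ n ih =>
      intro s t hn hst
      by_cases hc : Centroid (graft t s)
      · exact ⟨_, hc, rfl⟩
      simp only [Centroid, not_forall, not_le, children_graft, Multiset.mem_cons, size_graft] at hc
      obtain ⟨c, rfl | hc, h⟩ := hc
      · omega
      obtain ⟨r, rfl⟩ := eq_graft_of_mem hc
      have := size_pos r
      simp only [size_graft] at hn hst h
      rw [graft_right_comm, free_graft_comm]
      exact ih (graft r s) c (by omega) (by simp; omega)
  by_cases hc : Centroid x
  · exact ⟨x, hc, rfl⟩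
  simp only [Centroid, not_forall, not_le] at hc
  obtain ⟨c, hc, h⟩ := hc
  obtain ⟨s, rfl⟩ := eq_graft_of_mem hc
  simp only [size_graft] at h
  rw [free_graft_comm]
  exact key _ s c le_rfl (by omega)

/-- In a tree with an odd number of vertices the centroid is unique. -/
lemma Centroid.eq_of_free_eq_of_odd {x y : UTree} (hx : Centroid x) (hy : Centroid y)
    (ho : Odd (size x)) (h : free x = free y) : x = y := by
  rcases hx.eq_or_of_free_eq hy h with h | ⟨s, t, hst, rfl, -⟩
  · exact h
  · obtain ⟨k, hk⟩ := ho
    simp at hk; omega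

lemma size_lt_of_mem_children {c x : UTree} (h : c ∈ children x) : size c < size x := by
  obtain ⟨s, rfl⟩ := eq_graft_of_mem h
  have := size_pos s
  simp; omega

lemma centroid_graft_iff {s t : UTree} :
    Centroid (graft s t) ↔ size t ≤ size s ∧ ∀ c ∈ children s, 2 * size c ≤ size s + size t := by
  simp only [Centroid, children_graft, Multiset.mem_cons, forall_eq_or_imp, size_graft]
  exact and_congr_left fun _ => ⟨fun h => by omega, fun h => by omega⟩

/-- Joining two rooted trees by an edge between their roots. -/
def join : Sym2 UTree → Free :=
  Sym2.lift ⟨fun s t => free (graft s t), free_graft_comm⟩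

@[simp] lemma join_mk (s t : UTree) : join s(s, t) = free (graft s t) := rfl

/-- The two halves of a tree with two centroids are determined by the tree. -/
lemma halves_eq {m : ℕ} {s t s' t' : UTree} (hs : size s = m) (ht : size t = m)
    (hs' : size s' = m) (ht' : size t' = m) (h : free (graft s t) = free (graft s' t')) :
    s(s, t) = s(s', t') := by
  have cen : ∀ {s t : UTree}, size s = m → size t = m → Centroid (graft s t) := by
    intro s t hs ht
    refine centroid_graft_iff.2 ⟨by omega, fun c hc => ?_⟩
    have := size_lt_of_mem_children hc
    omega
  have inj : ∀ {s t s' t' : UTree}, size s = m → size t' = m → graft s t = graft s' t' →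
      s = s' ∧ t = t' := by
    intro s t s' t' hs ht' h
    rcases graft_eq_graft h with h | ⟨u, rfl, -⟩
    · exact h
    · have := size_pos u
      simp at hs; omega
  rcases (cen hs ht).eq_or_of_free_eq (cen hs' ht') h with h | ⟨a, b, hab, h1, h2⟩
  · obtain ⟨rfl, rfl⟩ := inj hs ht' h
    rfl
  · have h3 := congrArg size h1
    simp only [size_graft] at h3
    obtain ⟨rfl, rfl⟩ := inj hs (by omega) h1
    obtain ⟨rfl, rfl⟩ := inj hs' (by omega) h2
    exact Sym2.eq_swap

lemma eq_of_map_eq_of_injOn {α β : Type*} {f : α → β} {S : Set α} (hf : S.InjOn f)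
    {M M' : Multiset α} (hM : ∀ x ∈ M, x ∈ S) (hM' : ∀ x ∈ M', x ∈ S)
    (h : M.map f = M'.map f) : M = M' := by
  classical
  rcases isEmpty_or_nonempty α with _ | _
  · exact Subsingleton.elim _ _
  have key : ∀ N : Multiset α, (∀ x ∈ N, x ∈ S) → (N.map f).map (f.invFunOn S) = N := by
    intro N hN
    rw [Multiset.map_map]
    exact (Multiset.map_congr rfl fun x hx => hf.leftInvOn_invFunOn (hN x hx)).trans
      (Multiset.map_id N)
  rw [← key M hM, h, key M' hM']

/-- A branch of a leaf-deleted subtree is at most as large as some branch of the tree. -/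
lemma exists_size_le_of_mem_del {x z c : UTree} (hz : z ∈ del x) (hc : c ∈ children z) :
    ∃ c₀ ∈ children x, size c ≤ size c₀ := by
  obtain ⟨F, rfl⟩ := exists_node x
  obtain ⟨t, F, rfl, ⟨-, rfl⟩ | ⟨t', ht', rfl⟩⟩ := mem_del_node.1 hz
  · exact ⟨c, by simp at hc; simp [hc], le_rfl⟩
  · simp only [children_node, Multiset.mem_cons] at hc ⊢
    rcases hc with rfl | hc
    · exact ⟨t, .inl rfl, by have := size_of_mem_del ht'; omega⟩
    · exact ⟨c, .inr hc, le_rfl⟩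

/-! ### Trees with an odd number of vertices -/

/-- No branch at the root has exactly `m` vertices. -/
def Light (m : ℕ) (x : UTree) : Prop := ∀ c ∈ children x, size c ≠ m

lemma not_light_iff {m : ℕ} {x : UTree} : ¬ Light m x ↔ ∃ s t, size t = m ∧ x = graft s t := by
  simp only [Light, not_forall, not_not]
  constructor
  · rintro ⟨t, ht, h⟩
    obtain ⟨s, rfl⟩ := eq_graft_of_mem ht
    exact ⟨s, t, h, rfl⟩
  · rintro ⟨s, t, h, rfl⟩
    exact ⟨t, by simp, h⟩

lemma light_graft {m : ℕ} {s t : UTree} : Light m (graft s t) ↔ size t ≠ m ∧ Light m s := by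
  simp [Light]

section Odd

variable {m : ℕ} {y y' : UTree}

lemma Centroid.of_mem_del_odd (hy : Centroid y) (hs : size y = 2 * m + 1) {z : UTree}
    (hz : z ∈ del y) : Centroid z := by
  intro c hc
  obtain ⟨c₀, hc₀, hle⟩ := exists_size_le_of_mem_del hz hc
  have := hy c₀ hc₀
  have := size_of_mem_del hz
  omega

lemma exists_mem_del_of_odd (hy : Centroid y) (hy' : Centroid y') (hs : size y = 2 * m + 1)
    (hs' : size y' = 2 * m + 1) (H : (del y).map free = (del y').map free) {z : UTree}
    (hz : z ∈ del y) : ∃ z' ∈ del y', z = z' ∨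
      ∃ s t, size s = m ∧ size t = m ∧ z = graft s t ∧ z' = graft t s := by
  have h1 := Multiset.mem_map_of_mem free hz
  rw [H] at h1
  obtain ⟨z', hz', h⟩ := Multiset.mem_map.1 h1
  refine ⟨z', hz', ?_⟩
  rcases (hy.of_mem_del_odd hs hz).eq_or_of_free_eq (hy'.of_mem_del_odd hs' hz') h.symm with
    h | ⟨s, t, h1, rfl, rfl⟩
  · exact .inl h
  · have := size_of_mem_del hz
    simp only [size_graft] at this
    exact .inr ⟨s, t, by omega, by omega, rfl, rfl⟩

lemma mem_del_of_odd_of_light (hy : Centroid y) (hy' : Centroid y') (hs : size y = 2 * m + 1)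
    (hs' : size y' = 2 * m + 1) (H : (del y).map free = (del y').map free) {z : UTree}
    (hz : z ∈ del y) (hl : Light m z) : z ∈ del y' := by
  obtain ⟨z', hz', rfl | ⟨s, t, -, h, rfl, -⟩⟩ := exists_mem_del_of_odd hy hy' hs hs' H hz
  · exact hz'
  · exact absurd h (light_graft.1 hl).1

lemma light_of_mem_del {z : UTree} (hle : ∀ c ∈ children y, size c ≤ m) (hl : Light m y)
    (hz : z ∈ del y) : Light m z := by
  intro c hc h
  obtain ⟨c₀, hc₀, hle'⟩ := exists_size_le_of_mem_del hz hc
  exact hl c₀ hc₀ (by have := hle c₀ hc₀; omega)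

lemma Centroid.size_le_of_odd (hy : Centroid y) (hs : size y = 2 * m + 1) :
    ∀ c ∈ children y, size c ≤ m := fun c hc => by
  have := hy c hc
  omega

lemma light_of_odd_of_light (hm : 1 ≤ m) (hy : Centroid y) (hy' : Centroid y')
    (hs : size y = 2 * m + 1) (hs' : size y' = 2 * m + 1)
    (H : (del y).map free = (del y').map free) (hl : Light m y) : Light m y' := by
  by_contra hl'
  obtain ⟨x, K, hK, rfl⟩ := not_light_iff.1 hl'
  -- a deletion outside the branch `K` leaves a tree with a branch of `m` vertices
  obtain ⟨z, hz⟩ := exists_mem_del (x := x) (by rintro rfl; simp at hs'; omega)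
  have hz' : graft z K ∈ del (graft x K) := mem_del_graft_left K hz
  obtain ⟨w, hw, e | ⟨s, t, h1, h2, e1, e2⟩⟩ := exists_mem_del_of_odd hy' hy hs' hs H.symm hz' <;>
    have hwl := light_of_mem_del (hy.size_le_of_odd hs) hl hw
  · rw [← e, light_graft] at hwl
    exact hwl.1 hK
  · rw [e2, light_graft] at hwl
    exact hwl.1 h1

lemma eq_of_odd_of_light (hm : 1 ≤ m) (hy : Centroid y) (hy' : Centroid y')
    (hs : size y = 2 * m + 1) (hs' : size y' = 2 * m + 1)
    (H : (del y).map free = (del y').map free) (hl : Light m y) : y = y' := by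
  have hl' := light_of_odd_of_light hm hy hy' hs hs' H hl
  refine eq_of_del (hs.trans hs'.symm) (by simpa using congrArg Multiset.card H) fun z =>
    ⟨fun hz => ?_, fun hz => ?_⟩
  · exact mem_del_of_odd_of_light hy hy' hs hs' H hz
      (light_of_mem_del (hy.size_le_of_odd hs) hl hz)
  · exact mem_del_of_odd_of_light hy' hy hs' hs H.symm hz
      (light_of_mem_del (hy'.size_le_of_odd hs') hl' hz)

lemma del_graft_plant {A B : UTree} (hA : A ≠ leaf) (hB : B ≠ leaf) :
    (del (graft (plant A) B)).map free = (pairCards plantPair A B).map join := by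
  simp only [del_graft_of_ne _ hB, del_plant hA, pairCards, Multiset.map_add, Multiset.map_map,
    Function.comp_def, plantPair, join_mk]
  rw [add_comm]
  congr 1
  · exact Multiset.map_congr rfl fun b _ => by rw [graft_right_comm, free_graft_comm]
  · exact Multiset.map_congr rfl fun b _ => free_graft_comm _ _

/-- Two branches with `m` vertices each: every leaf-deleted subtree is halved by an edge. -/
lemma eq_of_odd_of_plant {A B A' B' : UTree} (hm : 2 ≤ m) (hA : size A = m) (hB : size B = m)
    (hA' : size A' = m) (hB' : size B' = m)
    (H : (del (graft (plant A) B)).map free = (del (graft (plant A') B')).map free) :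
    graft (plant A) B = graft (plant A') B' := by
  have ne : ∀ {x}, size x = m → x ≠ leaf := fun hx => ne_leaf_of_size hx hm
  rw [del_graft_plant (ne hA) (ne hB), del_graft_plant (ne hA') (ne hB')] at H
  have hP : ∀ {A B : UTree}, size A = m → size B = m → ∀ p ∈ pairCards plantPair A B,
      p ∈ {p : Sym2 UTree | ∀ x ∈ p, size x = m} := by
    intro A B hA hB p hp
    rcases mem_pairCards.1 hp with ⟨b, hb, rfl⟩ | ⟨b, hb, rfl⟩ <;>
      have := size_of_mem_del hb <;> simp [plantPair] <;> omega
  have hinj : Set.InjOn join {p : Sym2 UTree | ∀ x ∈ p, size x = m} := by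
    intro p hp q hq h
    induction p with | _ s t =>
    induction q with | _ s' t' =>
    exact halves_eq (hp s (by simp)) (hp t (by simp)) (hq s' (by simp)) (hq t' (by simp)) h
  have H := eq_of_map_eq_of_injOn hinj (hP hA hB) (hP hA' hB') H
  rcases pair_eq_of_plantPair hA hB hA' hB' (by rw [H]) (fun x => by rw [H]) with
    ⟨rfl, rfl⟩ | ⟨rfl, rfl⟩
  · rfl
  · exact graft_right_comm _ _ _

/-- Exactly one branch with `m` vertices. The deletions inside this branch leave a tree with a
unique centroid, the other ones a tree with two centroids. -/
lemma eq_of_odd_of_one {A B A' B' : UTree} (hm : 2 ≤ m) (hA : size A = m)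
    (hA' : size A' = m) (hB : Light m B) (hB' : Light m B')
    (hy : Centroid (graft B A)) (hy' : Centroid (graft B' A'))
    (hs : size (graft B A) = 2 * m + 1) (hs' : size (graft B' A') = 2 * m + 1)
    (H : (del (graft B A)).map free = (del (graft B' A')).map free) :
    graft B A = graft B' A' := by
  have nA := ne_leaf_of_size hA hm
  have nA' := ne_leaf_of_size hA' hm
  have inside : ∀ {A B A' B' : UTree}, size A = m → size A' = m → Light m B →
      Centroid (graft B A) → Centroid (graft B' A') → size (graft B A) = 2 * m + 1 →
      size (graft B' A') = 2 * m + 1 → (del (graft B A)).map free = (del (graft B' A')).map free →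
      ∀ a ∈ del A, ∃ a' ∈ del A', graft B a = graft B' a' := by
    intro A B A' B' hA hA' hB hy hy' hs hs' H a ha
    have sa := size_eq_of_mem_del hA ha
    have hl : Light m (graft B a) := light_graft.2 ⟨by omega, hB⟩
    have := mem_del_of_odd_of_light hy hy' hs hs' H (mem_del_graft_right B ha) hl
    rw [del_graft_of_ne _ (ne_leaf_of_size hA' hm), Multiset.mem_add] at this
    rcases this with h | h
    · obtain ⟨z, -, hz⟩ := Multiset.mem_map.1 h
      rw [← hz, light_graft] at hl
      exact absurd hA' hl.1
    · obtain ⟨a', ha', e⟩ := Multiset.mem_map.1 h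
      exact ⟨a', ha', e.symm⟩
  have in₁ := inside hA hA' hB hy hy' hs hs' H
  have in₂ := inside hA' hA hB' hy' hy hs' hs H.symm
  simp only [size_graft] at hs hs'
  by_cases hBB : B = B'
  · subst hBB
    congr 1
    refine eq_of_del (hA.trans hA'.symm) ?_ fun a => ⟨fun ha => ?_, fun ha => ?_⟩
    · have := congrArg Multiset.card H
      rw [del_graft_of_ne _ nA, del_graft_of_ne _ nA'] at this
      simpa using this
    · obtain ⟨a', ha', e⟩ := in₁ a ha
      rwa [graft_right_inj.1 e]
    · obtain ⟨a', ha', e⟩ := in₂ a ha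
      rwa [graft_right_inj.1 e]
  exfalso
  -- otherwise `B` and `B'` consist of the root, a leaf and a branch with `m - 1` vertices
  obtain ⟨a, ha⟩ := exists_mem_del nA
  obtain ⟨a', ha', e⟩ := in₁ a ha
  have sa := size_eq_of_mem_del hA ha
  have sa' := size_eq_of_mem_del hA' ha'
  obtain ⟨u, rfl, rfl⟩ := (graft_eq_graft e).resolve_left fun h => hBB h.1
  simp only [size_graft] at hs hs'
  obtain rfl : u = plant leaf := eq_plant_leaf_of_size (by omega)
  have haa : a ≠ a' := fun h => hBB (by rw [h])
  have na : 2 ≤ size a := by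
    by_contra h
    have := size_pos a
    exact haa (by rw [size_eq_one_iff.1 (show size a = 1 by omega),
      size_eq_one_iff.1 (show size a' = 1 by omega)])
  have ne : ∀ {x}, size x + 1 = m → x ≠ leaf := fun hx =>
    ne_leaf_of_size (k := m - 1) (by omega) (by omega)
  have hAA : A ≠ A' := by
    rintro rfl
    obtain ⟨a₁, -, e⟩ := in₂ a ha
    have e := congrArg children e
    simp only [children_graft, children_leaf] at e
    have : a' ∈ a ::ₘ a ::ₘ leaf ::ₘ 0 := by rw [e]; simp
    simp only [Multiset.mem_cons, Multiset.notMem_zero, or_false] at this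
    rcases this with h | h | h
    · exact haa h.symm
    · exact haa h.symm
    · exact ne sa' h
  -- the deletions outside `A` all lead to a tree whose other half is `A'`
  have outside : ∀ z ∈ del (graft (plant leaf) a'), z = A' := by
    intro z hz
    obtain ⟨w, hw, h⟩ : ∃ w ∈ del (graft (graft (plant leaf) a) A'), free w = free (graft z A) := by
      have := Multiset.mem_map_of_mem free (mem_del_graft_left A hz)
      rw [H] at this
      exact Multiset.mem_map.1 this
    have sz := size_of_mem_del hz
    simp only [size_graft, size_leaf] at sz
    rw [del_graft_of_ne _ nA', Multiset.mem_add] at hw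
    rcases hw with hw | hw <;> obtain ⟨v, hv, rfl⟩ := Multiset.mem_map.1 hw
    · have sv := size_of_mem_del hv
      simp only [size_graft, size_leaf] at sv
      have := halves_eq (by omega) hA' (by omega) hA h
      rcases Sym2.eq_iff.1 this with ⟨-, h⟩ | ⟨-, h⟩
      · exact absurd h.symm hAA
      · exact h.symm
    · have sv := size_eq_of_mem_del hA' hv
      have hc := hy'.of_mem_del_odd (m := m) (by simp; omega) (mem_del_graft_right _ hv)
      have hc' := hy.of_mem_del_odd (m := m) (by simp; omega) (mem_del_graft_left A hz)
      rcases hc.eq_or_of_free_eq hc' h with h | ⟨s, t, hst, h, -⟩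
      · exfalso
        have : A ∈ children (graft (graft (plant leaf) a) v) := by rw [h]; simp
        simp only [children_graft, children_leaf, Multiset.mem_cons] at this
        rcases this with rfl | rfl | rfl | this
        · omega
        · omega
        · exact nA rfl
        · simp at this
      · exfalso
        have h1 := congrArg size h
        have : t ∈ children (graft (graft (plant leaf) a) v) := by rw [h]; simp
        simp only [children_graft, children_leaf, Multiset.mem_cons] at this
        simp only [size_graft, size_leaf] at h1
        rcases this with rfl | rfl | rfl | this
        · omega
        · omega
        · simp at h1 hst; omega
        · simp at this
  obtain ⟨a'', ha''⟩ := exists_mem_del (ne sa')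
  have h1 := outside _ (mem_del_graft_right _ ha'')
  have h2 := outside (plant a') (by
    rw [graft_right_comm, del_graft_leaf]
    simp)
  have := congrArg (fun x => (children x).card) (h1.trans h2.symm)
  simp at this

lemma light_of_odd_of_one {A B A' B' : UTree} (hm : 2 ≤ m) (hA : size A = m)
    (hB : Light m B) (hB' : ¬ Light m B') (hA' : size A' = m)
    (hy : Centroid (graft B A)) (hy' : Centroid (graft B' A'))
    (hs : size (graft B A) = 2 * m + 1) (hs' : size (graft B' A') = 2 * m + 1)
    (H : (del (graft B A)).map free = (del (graft B' A')).map free) : False := by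
  obtain ⟨a, ha⟩ := exists_mem_del (ne_leaf_of_size hA hm)
  have sa := size_eq_of_mem_del hA ha
  have hl : Light m (graft B a) := light_graft.2 ⟨by omega, hB⟩
  have hz := mem_del_of_odd_of_light hy hy' hs hs' H (mem_del_graft_right B ha) hl
  rw [del_graft_of_ne _ (ne_leaf_of_size hA' hm), Multiset.mem_add] at hz
  rcases hz with hz | hz <;> obtain ⟨v, -, hv⟩ := Multiset.mem_map.1 hz <;>
    rw [← hv, light_graft] at hl
  · exact hl.1 hA'
  · exact hB' hl.2

theorem eq_of_odd (hm : 1 ≤ m) (hy : Centroid y) (hy' : Centroid y')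
    (hs : size y = 2 * m + 1) (hs' : size y' = 2 * m + 1)
    (H : (del y).map free = (del y').map free) : y = y' := by
  by_cases hl : Light m y
  · exact eq_of_odd_of_light hm hy hy' hs hs' H hl
  by_cases hl' : Light m y'
  · exact (eq_of_odd_of_light hm hy' hy hs' hs H.symm hl').symm
  obtain ⟨B, A, hA, rfl⟩ := not_light_iff.1 hl
  obtain ⟨B', A', hA', rfl⟩ := not_light_iff.1 hl'
  have two : ∀ {A B : UTree}, size A = m → size (graft B A) = 2 * m + 1 → ¬ Light m B →
      ∃ C, size C = m ∧ B = plant C := by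
    intro A B hA hs hB
    obtain ⟨s, C, hC, rfl⟩ := not_light_iff.1 hB
    simp only [size_graft] at hs
    exact ⟨C, hC, by rw [size_eq_one_iff.1 (show size s = 1 by omega)]⟩
  rcases (by omega : m = 1 ∨ 2 ≤ m) with rfl | hm
  · simp only [size_graft] at hs hs'
    rw [size_eq_one_iff.1 hA, size_eq_one_iff.1 hA', eq_plant_leaf_of_size (x := B) (by omega),
      eq_plant_leaf_of_size (x := B') (by omega)]
  · by_cases hB : Light m B <;> by_cases hB' : Light m B'
    · exact eq_of_odd_of_one hm hA hA' hB hB' hy hy' hs hs' H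
    · exact (light_of_odd_of_one hm hA hB hB' hA' hy hy' hs hs' H).elim
    · exact (light_of_odd_of_one hm hA' hB' hB hA hy' hy hs' hs H.symm).elim
    · obtain ⟨C, hC, rfl⟩ := two hA hs hB
      obtain ⟨C', hC', rfl⟩ := two hA' hs' hB'
      exact eq_of_odd_of_plant hm hC hA hC' hA' H

end Odd

/-! ### Trees with an even number of vertices -/

section Even

variable {m : ℕ} {y y' : UTree}

lemma injOn_free_odd : Set.InjOn free {x | Centroid x ∧ Odd (size x)} :=
  fun _ hx _ hy h => hx.1.eq_of_free_eq_of_odd hy.1 hx.2 h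

lemma mem_centroid_odd_of_mem_del (hy : Centroid y) (hs : size y = 2 * m) (hl : Light m y)
    {z : UTree} (hz : z ∈ del y) : z ∈ {x | Centroid x ∧ Odd (size x)} := by
  have sz := size_of_mem_del hz
  have := size_pos z
  refine ⟨fun c hc => ?_, m - 1, by omega⟩
  obtain ⟨c₀, hc₀, hle⟩ := exists_size_le_of_mem_del hz hc
  have := hy c₀ hc₀
  have := hl c₀ hc₀
  omega

lemma mem_centroid_odd_of_mem_pairCards {A B : UTree} (hA : size A = m) (hB : size B = m)
    {z : UTree} (hz : z ∈ pairCards graft A B) : z ∈ {x | Centroid x ∧ Odd (size x)} := by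
  have key : ∀ {A b : UTree}, size A = m → size b + 1 = m →
      graft A b ∈ {x | Centroid x ∧ Odd (size x)} := by
    intro A b hA hb
    refine ⟨centroid_graft_iff.2 ⟨by omega, fun c hc => ?_⟩, m - 1, by simp; omega⟩
    have := size_lt_of_mem_children hc
    omega
  rcases mem_pairCards.1 hz with ⟨b, hb, rfl⟩ | ⟨a, ha, rfl⟩
  · exact key hA (size_eq_of_mem_del hB hb)
  · exact key hB (size_eq_of_mem_del hA ha)

lemma map_free_del_graft (A : UTree) {B : UTree} (hB : B ≠ leaf) :
    (del (graft A B)).map free = (pairCards graft A B).map free := by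
  rw [del_graft_of_ne _ hB, pairCards, Multiset.map_add, Multiset.map_add, add_comm]
  simp [Multiset.map_map, free_graft_comm B]

lemma eq_plant_of_mem_children {A c : UTree} (hA : size A = m) (hc : c ∈ children A)
    (h : size c + 1 = m) : A = plant c := by
  obtain ⟨s, rfl⟩ := eq_graft_of_mem hc
  simp only [size_graft] at hA
  rw [size_eq_one_iff.1 (show size s = 1 by omega)]

/-- The tree whose root has two branches `x` and `y`. -/
lemma graft_plant_comm (x y : UTree) : graft (plant x) y = graft (plant y) x :=
  graft_right_comm _ _ _

/-- The rooted tree with the two given branches. -/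
noncomputable def nodePair : Sym2 UTree → UTree :=
  Sym2.lift ⟨fun x y => graft (plant x) y, graft_plant_comm⟩

lemma nodePair_injective : Function.Injective nodePair := by
  intro p q h
  induction p with | _ x y =>
  induction q with | _ x' y' =>
  rcases graft_eq_graft (h : graft (plant x) y = graft (plant x') y') with ⟨h1, h2⟩ | ⟨u, h1, h2⟩
  · obtain rfl : x = x' := plant_injective h1
    obtain rfl : y = y' := h2
    rfl
  · have h1' := congrArg children h1
    have h2' := congrArg children h2
    simp only [children_graft, children_leaf, Multiset.cons_eq_cons] at h1' h2'
    have e1 : x = y' := by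
      rcases h1' with h | ⟨-, _, h, -⟩
      · exact h.1
      · simp at h
    have e2 : x' = y := by
      rcases h2' with h | ⟨-, _, h, -⟩
      · exact h.1
      · simp at h
    rw [e1, e2, Sym2.eq_swap]

lemma pairCards_graft_plant {A B : UTree} (hA : A ≠ leaf) (hB : B ≠ leaf) :
    pairCards graft (plant A) (plant B) = (pairCards plantPair A B).map nodePair := by
  simp [pairCards, del_plant hA, del_plant hB, plantPair, Multiset.map_map, Function.comp_def,
    nodePair]

/-- Two trees, both with two centroids. -/
lemma pair_eq_of_even {A B A' B' : UTree} (hm : 2 ≤ m) (hA : size A = m) (hB : size B = m)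
    (hA' : size A' = m) (hB' : size B' = m) (H : pairCards graft A B = pairCards graft A' B') :
    (A = A' ∧ B = B') ∨ (A = B' ∧ B = A') := by
  have hf : ∀ A b A' b', (∀ c ∈ children A, size c + 1 ≠ m) → size A = m → size A' = m →
      size b + 1 = m → size b' + 1 = m → graft A b = graft A' b' → A = A' ∧ b = b' := by
    intro A b A' b' hg _ _ _ hb' e
    refine (graft_eq_graft e).resolve_right ?_
    rintro ⟨u, rfl, -⟩
    exact hg b' (by simp) hb'
  by_cases hg : (∀ c ∈ children A, size c + 1 ≠ m) ∨ ∀ c ∈ children B, size c + 1 ≠ m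
  · exact pair_eq_of_pairCards hm hf hA hB hA' hB' (by rw [H]) (fun x => by rw [H]) hg
  by_cases hg' : (∀ c ∈ children A', size c + 1 ≠ m) ∨ ∀ c ∈ children B', size c + 1 ≠ m
  · have := pair_eq_of_pairCards hm hf hA' hB' hA hB (by rw [H]) (fun x => by rw [H]) hg'
    rcases this with ⟨rfl, rfl⟩ | ⟨rfl, rfl⟩ <;> simp
  have planted : ∀ {A : UTree}, size A = m → ¬ (∀ c ∈ children A, size c + 1 ≠ m) →
      ∃ c, size c + 1 = m ∧ A = plant c := by
    intro A hA h
    simp only [ne_eq, not_forall, not_not] at h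
    obtain ⟨c, hc, h⟩ := h
    exact ⟨c, h, eq_plant_of_mem_children hA hc h⟩
  rw [not_or] at hg hg'
  obtain ⟨a, ha, rfl⟩ := planted hA hg.1
  obtain ⟨b, hb, rfl⟩ := planted hB hg.2
  obtain ⟨a', ha', rfl⟩ := planted hA' hg'.1
  obtain ⟨b', hb', rfl⟩ := planted hB' hg'.2
  rcases (by omega : m = 2 ∨ 3 ≤ m) with rfl | hm
  · have : ∀ {x : UTree}, size x + 1 = 2 → x = leaf := fun h => size_eq_one_iff.1 (by omega)
    rw [this ha, this hb, this ha', this hb']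
    simp
  · have ne : ∀ {x}, size x + 1 = m → x ≠ leaf := fun hx =>
      ne_leaf_of_size (k := m - 1) (by omega) (by omega)
    rw [pairCards_graft_plant (ne ha) (ne hb), pairCards_graft_plant (ne ha') (ne hb')] at H
    have H := Multiset.map_injective nodePair_injective H
    rcases pair_eq_of_plantPair (k := m - 1) (A := a) (B := b) (A' := a') (B' := b')
      (by omega) (by omega) (by omega) (by omega) (by rw [H]) (fun x => by rw [H]) with
      ⟨rfl, rfl⟩ | ⟨rfl, rfl⟩ <;> simp

/-- A tree with two centroids does not have the same leaf-deleted subtrees as a tree with a unique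
centroid. Every subtree has a branch with `m - 1` vertices, so the latter tree consists of a
centroid, a leaf and two branches with `m - 1` vertices; deleting the leaf is its only deletion that
leaves a centroid of degree two, which is incompatible with the former tree. -/
lemma not_del_eq_pairCards {A B : UTree} (hm : 2 ≤ m) (hA : size A = m) (hB : size B = m)
    (hy : Centroid y) (hs : size y = 2 * m) (hl : Light m y)
    (H : pairCards graft A B = del y) : False := by
  have nA := ne_leaf_of_size hA hm
  have nB := ne_leaf_of_size hB hm
  have big : ∀ z ∈ del y, ∃ c ∈ children z, size c + 1 = m := by
    intro z hz
    rw [← H, mem_pairCards] at hz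
    rcases hz with ⟨b, hb, rfl⟩ | ⟨a, ha, rfl⟩
    · exact ⟨b, by simp, size_eq_of_mem_del hB hb⟩
    · exact ⟨a, by simp, size_eq_of_mem_del hA ha⟩
  have le : ∀ c ∈ children y, size c + 1 ≤ m := fun c hc => by
    have := hy c hc
    have := hl c hc
    omega
  obtain ⟨K₁, hK₁, s₁⟩ : ∃ K ∈ children y, size K + 1 = m := by
    obtain ⟨z, hz⟩ := exists_mem_del (x := y) (by rintro rfl; simp at hs; omega)
    obtain ⟨c, hc, h⟩ := big z hz
    obtain ⟨K, hK, h'⟩ := exists_size_le_of_mem_del hz hc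
    exact ⟨K, hK, by have := le K hK; omega⟩
  obtain ⟨x, rfl⟩ := eq_graft_of_mem hK₁
  rcases (by omega : m = 2 ∨ 3 ≤ m) with rfl | hm
  · -- the star with three edges and the path with three edges
    rw [eq_plant_leaf_of_size hA, eq_plant_leaf_of_size hB] at H
    have h3 : (children (graft x K₁)).card = 3 := by
      have h1 : ∀ c ∈ children (graft x K₁), size c = 1 := fun c hc => by
        have := le c hc
        have := size_pos c
        omega
      have h2 := size_node (children (graft x K₁))
      rw [node_children, hs, Multiset.map_congr rfl h1] at h2
      simp at h2 ⊢
      omega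
    have h4 := card_children_le_card_del (graft x K₁)
    rw [← H, h3] at h4
    simp [pairCards, del_graft] at h4
  have ne : ∀ {x}, size x + 1 = m → x ≠ leaf := fun hx =>
    ne_leaf_of_size (k := m - 1) (by omega) (by omega)
  obtain ⟨K₁', hK₁'⟩ := exists_mem_del (ne s₁)
  have s₁' := size_of_mem_del hK₁'
  obtain ⟨K₂, hK₂, s₂⟩ := big _ (mem_del_graft_right x hK₁')
  simp only [children_graft, Multiset.mem_cons] at hK₂
  obtain ⟨x, rfl⟩ := eq_graft_of_mem (hK₂.resolve_left (by rintro rfl; omega))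
  simp only [size_graft] at hs
  obtain rfl : x = plant leaf := eq_plant_leaf_of_size (by omega)
  clear hK₂ le big hl hy hs
  classical
  -- `P` singles out the trees whose root has two branches
  set P : UTree → Prop := fun z => (children z).card = 2 with hP
  have hcount : (del (graft (graft (plant leaf) K₂) K₁)).countP P = 1 := by
    rw [del_graft_of_ne _ (ne s₁), del_graft_of_ne _ (ne s₂), del_graft_leaf]
    simp [hP, Multiset.countP_map]
  have hthree : ∃ z ∈ pairCards graft A B, ¬ P z :=
    ⟨_, H ▸ mem_del_graft_right _ hK₁', by simp [hP]⟩
  have htwo : ∃ z ∈ pairCards graft A B, P z := by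
    rw [H]
    exact Multiset.countP_pos.1 (by omega)
  rw [← H] at hcount
  clear H
  wlog hAB : (children A).card = 1 generalizing A B
  · refine this hB hA nB nA (by rwa [pairCards_comm]) (by rwa [pairCards_comm])
      (by rwa [pairCards_comm]) ?_
    obtain ⟨z, hz, h⟩ := htwo
    rcases mem_pairCards.1 hz with ⟨b, hb, rfl⟩ | ⟨a, ha, rfl⟩ <;> simp [hP] at h
    · exact absurd (by simp [h]) hAB
    · simp [h]
  have hc : ∀ b ∈ del B, P (graft A b) := fun b _ => by simp [hP, hAB]
  rw [pairCards, Multiset.countP_add, Multiset.countP_map,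
    Multiset.filter_eq_self.2 hc] at hcount
  have h1 := card_children_le_card_del B
  have h2 : (children B).card ≠ 0 := by
    intro h
    exact nB (children_injective (by simpa using h))
  have h3 : (children B).card = 1 := by omega
  obtain ⟨z, hz, h⟩ := hthree
  rcases mem_pairCards.1 hz with ⟨b, hb, rfl⟩ | ⟨a, ha, rfl⟩ <;> simp [hP, hAB, h3] at h

theorem free_eq_of_even (hm : 2 ≤ m) (hy : Centroid y) (hy' : Centroid y')
    (hs : size y = 2 * m) (hs' : size y' = 2 * m)
    (H : (del y).map free = (del y').map free) : free y = free y' := by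
  have halves : ∀ {y : UTree}, size y = 2 * m → ¬ Light m y →
      ∃ A B, size A = m ∧ size B = m ∧ y = graft A B := by
    intro y hs hl
    obtain ⟨A, B, hB, rfl⟩ := not_light_iff.1 hl
    exact ⟨A, B, by simp at hs; omega, hB, rfl⟩
  have ne : ∀ {x}, size x = m → x ≠ leaf := fun hx => ne_leaf_of_size hx hm
  by_cases hl : Light m y <;> by_cases hl' : Light m y'
  · have H := eq_of_map_eq_of_injOn injOn_free_odd
      (fun _ => mem_centroid_odd_of_mem_del hy hs hl)
      (fun _ => mem_centroid_odd_of_mem_del hy' hs' hl') H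
    rw [eq_of_del (hs.trans hs'.symm) (by rw [H]) fun z => by rw [H]]
  · obtain ⟨A, B, hA, hB, rfl⟩ := halves hs' hl'
    rw [map_free_del_graft _ (ne hB)] at H
    exact (not_del_eq_pairCards hm hA hB hy hs hl
      (eq_of_map_eq_of_injOn injOn_free_odd (fun _ => mem_centroid_odd_of_mem_pairCards hA hB)
        (fun _ => mem_centroid_odd_of_mem_del hy hs hl) H.symm)).elim
  · obtain ⟨A, B, hA, hB, rfl⟩ := halves hs hl
    rw [map_free_del_graft _ (ne hB)] at H
    exact (not_del_eq_pairCards hm hA hB hy' hs' hl'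
      (eq_of_map_eq_of_injOn injOn_free_odd (fun _ => mem_centroid_odd_of_mem_pairCards hA hB)
        (fun _ => mem_centroid_odd_of_mem_del hy' hs' hl') H)).elim
  · obtain ⟨A, B, hA, hB, rfl⟩ := halves hs hl
    obtain ⟨A', B', hA', hB', rfl⟩ := halves hs' hl'
    rw [map_free_del_graft _ (ne hB), map_free_del_graft _ (ne hB')] at H
    have H := eq_of_map_eq_of_injOn injOn_free_odd
      (fun _ => mem_centroid_odd_of_mem_pairCards hA hB)
      (fun _ => mem_centroid_odd_of_mem_pairCards hA' hB') H
    rcases pair_eq_of_even hm hA hB hA' hB' H with ⟨rfl, rfl⟩ | ⟨rfl, rfl⟩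
    · rfl
    · exact free_graft_comm _ _

/-- A tree with at least three vertices, rooted at a centroid, is determined up to the choice of
the root by its leaf-deleted subtrees, considered as trees without a root. -/
theorem free_eq_of_map_free_del (h3 : 3 ≤ size y) (hy : Centroid y) (hy' : Centroid y')
    (hs : size y = size y') (H : (del y).map free = (del y').map free) : free y = free y' := by
  obtain ⟨m, hm⟩ := Nat.even_or_odd' (size y)
  rcases hm with hm | hm
  · exact free_eq_of_even (m := m) (by omega) hy hy' hm (by omega) H
  · rw [eq_of_odd (m := m) (by omega) hy hy' hm (by omega) H]

end Even

end UTree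

/-! ### Plane trees as graphs -/

section link

variable {V W V' W' : Type*}

/-- The disjoint union of two graphs together with an edge between `r` and `q`. -/
def link (G : SimpleGraph V) (r : V) (H : SimpleGraph W) (q : W) : SimpleGraph (V ⊕ W) where
  Adj
    | .inl a, .inl b => G.Adj a b
    | .inr a, .inr b => H.Adj a b
    | .inl a, .inr b => a = r ∧ b = q
    | .inr b, .inl a => a = r ∧ b = q
  symm := ⟨by rintro (a | a) (b | b) h <;> first | exact h | exact h.symm⟩
  loopless := ⟨by rintro (a | a) h <;> exact h.ne rfl⟩

variable {G : SimpleGraph V} {r : V} {H : SimpleGraph W} {q : W}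

@[simp] lemma link_adj_inl_inl {a b : V} :
    (link G r H q).Adj (.inl a) (.inl b) ↔ G.Adj a b := .rfl

@[simp] lemma link_adj_inr_inr {a b : W} :
    (link G r H q).Adj (.inr a) (.inr b) ↔ H.Adj a b := .rfl

@[simp] lemma link_adj_inl_inr {a : V} {b : W} :
    (link G r H q).Adj (.inl a) (.inr b) ↔ a = r ∧ b = q := .rfl

@[simp] lemma link_adj_inr_inl {a : V} {b : W} :
    (link G r H q).Adj (.inr b) (.inl a) ↔ a = r ∧ b = q := .rfl

variable {G' : SimpleGraph V'} {r' : V'} {H' : SimpleGraph W'} {q' : W'}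

/-- Linking is functorial for embeddings that respect the linked vertices. -/
def linkEmbedding (f : G ↪g G') (g : H ↪g H') (hf : f r = r') (hg : g q = q') :
    link G r H q ↪g link G' r' H' q' where
  toEmbedding := f.toEmbedding.sumMap g.toEmbedding
  map_rel_iff' {a b} := by
    subst hf hg
    rcases a with a | a <;> rcases b with b | b <;> simp [Function.Embedding.sumMap]

/-- Linking is functorial for isomorphisms that respect the linked vertices. -/
def linkIso (f : G ≃g G') (g : H ≃g H') (hf : f r = r') (hg : g q = q') :
    link G r H q ≃g link G' r' H' q' where
  toEquiv := f.toEquiv.sumCongr g.toEquiv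
  map_rel_iff' {a b} := by
    subst hf hg
    rcases a with a | a <;> rcases b with b | b <;> simp [SimpleGraph.Iso.map_adj_iff]

/-- The two sides of a link may be exchanged. -/
def linkComm : link G r H q ≃g link H q G r where
  toEquiv := Equiv.sumComm V W
  map_rel_iff' {a b} := by
    rcases a with a | a <;> rcases b with b | b <;> simp [and_comm]

/-- The inclusion of the left-hand side of a link. -/
def linkInl : G ↪g link G r H q where
  toEmbedding := .inl
  map_rel_iff' := .rfl

/-- Two graphs linked to the same vertex may be exchanged. -/
def linkRightComm {K : SimpleGraph V'} {p : V'} :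
    link (link G r H q) (.inl r) K p ≃g link (link G r K p) (.inl r) H q where
  toEquiv := (Equiv.sumAssoc V W V').trans
    (((Equiv.refl V).sumCongr (Equiv.sumComm W V')).trans (Equiv.sumAssoc V V' W).symm)
  map_rel_iff' {a b} := by
    rcases a with (a | a) | a <;> rcases b with (b | b) | b <;> simp

/-- A property that holds at `r` and spreads along the edges of `G` holds at all vertices. -/
def Spans (G : SimpleGraph V) (r : V) : Prop :=
  ∀ P : V → Prop, P r → (∀ v w, G.Adj v w → P v → P w) → ∀ v, P v

lemma Spans.link (hG : Spans G r) (hH : Spans H q) : Spans (link G r H q) (.inl r) := by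
  intro P h0 h
  have hl := hG (fun v => P (.inl v)) h0 fun v w e => h (.inl v) (.inl w) e
  have hr := hH (fun v => P (.inr v)) (h (.inl r) (.inr q) ⟨rfl, rfl⟩ h0)
    fun v w e => h (.inr v) (.inr w) e
  rintro (v | v)
  · exact hl v
  · exact hr v

lemma link_map_inl (hG : Spans G r) (φ : link G r H q ≃g link G' r' H' q')
    (h1 : φ (.inl r) = .inl r') (h2 : φ (.inr q) = .inr q') (v : V) :
    ∃ v', φ (.inl v) = .inl v' := by
  refine hG (fun v => ∃ v', φ (.inl v) = .inl v') ⟨_, h1⟩ ?_ v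
  rintro v w e ⟨v', hv⟩
  have e' := φ.map_adj_iff.2 (link_adj_inl_inl.2 e)
  rcases hw : φ (.inl w) with w' | w'
  · exact ⟨w', rfl⟩
  · rw [hv, hw] at e'
    obtain ⟨-, rfl⟩ := e'
    exact absurd (φ.injective (hw.trans h2.symm)) Sum.inl_ne_inr

lemma link_map_inr (hH : Spans H q) (φ : link G r H q ≃g link G' r' H' q')
    (h1 : φ (.inl r) = .inl r') (h2 : φ (.inr q) = .inr q') (v : W) :
    ∃ v', φ (.inr v) = .inr v' := by
  refine hH (fun v => ∃ v', φ (.inr v) = .inr v') ⟨_, h2⟩ ?_ v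
  rintro v w e ⟨v', hv⟩
  have e' := φ.map_adj_iff.2 (link_adj_inr_inr.2 e)
  rcases hw : φ (.inr w) with w' | w'
  · rw [hv, hw] at e'
    obtain ⟨rfl, -⟩ := e'
    exact absurd (φ.injective (hw.trans h1.symm)) Sum.inr_ne_inl
  · exact ⟨w', rfl⟩

/-- Isomorphism of graphs with a distinguished vertex. -/
def RIso (G : SimpleGraph V) (r : V) (H : SimpleGraph W) (q : W) : Prop :=
  ∃ φ : G ≃g H, φ r = q

lemma RIso.refl (G : SimpleGraph V) (r : V) : RIso G r G r := ⟨.refl, rfl⟩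

lemma RIso.symm (h : RIso G r H q) : RIso H q G r := by
  obtain ⟨φ, rfl⟩ := h
  exact ⟨φ.symm, by simp⟩

lemma RIso.trans (h : RIso G r H q) (h' : RIso H q G' r') : RIso G r G' r' := by
  obtain ⟨φ, rfl⟩ := h
  obtain ⟨ψ, rfl⟩ := h'
  exact ⟨φ.trans ψ, rfl⟩

/-- An isomorphism between two connected links that respects the linked vertices restricts to both
sides. -/
lemma riso_of_link (hG : Spans G r) (hH : Spans H q) (hG' : Spans G' r') (hH' : Spans H' q')
    (φ : link G r H q ≃g link G' r' H' q') (h1 : φ (.inl r) = .inl r')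
    (h2 : φ (.inr q) = .inr q') : RIso G r G' r' ∧ RIso H q H' q' := by
  have h1' : φ.symm (.inl r') = .inl r := by rw [← h1, φ.symm_apply_apply]
  have h2' : φ.symm (.inr q') = .inr q := by rw [← h2, φ.symm_apply_apply]
  choose f hf using link_map_inl hG φ h1 h2
  choose f' hf' using link_map_inl hG' φ.symm h1' h2'
  choose g hg using link_map_inr hH φ h1 h2
  choose g' hg' using link_map_inr hH' φ.symm h1' h2'
  constructor
  · refine ⟨⟨⟨f, f', fun v => ?_, fun v => ?_⟩, fun {a b} => ?_⟩, ?_⟩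
    · exact Sum.inl_injective (by rw [← hf', ← hf, φ.symm_apply_apply])
    · exact Sum.inl_injective (by rw [← hf, ← hf', φ.apply_symm_apply])
    · change G'.Adj (f a) (f b) ↔ G.Adj a b
      rw [← link_adj_inl_inl (r := r') (H := H') (q := q'), ← hf, ← hf, φ.map_adj_iff,
        link_adj_inl_inl]
    · exact Sum.inl_injective ((hf _).symm.trans h1)
  · refine ⟨⟨⟨g, g', fun v => ?_, fun v => ?_⟩, fun {a b} => ?_⟩, ?_⟩
    · exact Sum.inr_injective (by rw [← hg', ← hg, φ.symm_apply_apply])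
    · exact Sum.inr_injective (by rw [← hg, ← hg', φ.apply_symm_apply])
    · change H'.Adj (g a) (g b) ↔ H.Adj a b
      rw [← link_adj_inr_inr (G := G') (r := r') (q := q'), ← hg, ← hg, φ.map_adj_iff,
        link_adj_inr_inr]
    · exact Sum.inr_injective ((hg _).symm.trans h2)

end link

namespace PlaneTree

open UTree

/-- The vertices of a plane tree. -/
abbrev Vert : PlaneTree → Type
  | leaf => Unit
  | graft s t => Vert s ⊕ Vert t

/-- The root of a plane tree. -/
def root : (p : PlaneTree) → Vert p
  | leaf => ()
  | graft s _ => .inl (root s)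

/-- The graph of a plane tree. -/
def graph : (p : PlaneTree) → SimpleGraph (Vert p)
  | leaf => ⊥
  | graft s t => link (graph s) (root s) (graph t) (root t)

instance : Subsingleton (Vert leaf) := inferInstanceAs (Subsingleton Unit)

lemma finite_vert_and_card (p : PlaneTree) : Finite (Vert p) ∧ Nat.card (Vert p) = size (mk p) := by
  induction p with
  | leaf => exact ⟨inferInstanceAs (Finite Unit), Nat.card_unique (α := Unit)⟩
  | graft s t hs ht =>
    obtain ⟨_, hs⟩ := hs
    obtain ⟨_, ht⟩ := ht
    exact ⟨inferInstanceAs (Finite (Vert s ⊕ Vert t)), by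
      rw [mk_graft, size_graft, ← hs, ← ht]
      exact Nat.card_sum⟩

instance (p : PlaneTree) : Finite (Vert p) := (finite_vert_and_card p).1

lemma spans_graph (p : PlaneTree) : Spans p.graph p.root := by
  induction p with
  | leaf => exact fun P h0 _ v => Subsingleton.elim (root leaf) v ▸ h0
  | graft s t hs ht => exact hs.link ht

lemma riso_of_mk_eq {p q : PlaneTree} (h : mk p = mk q) :
    RIso p.graph p.root q.graph q.root := by
  replace h : Relation.EqvGen Rel p q := Quot.eqvGen_exact h
  induction h with
  | rel p q h =>
    induction h with
    | swap a b c => exact ⟨linkRightComm, rfl⟩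
    | left t _ ih =>
      obtain ⟨φ, hφ⟩ := ih
      exact ⟨linkIso φ .refl hφ rfl, congrArg Sum.inl hφ⟩
    | right s _ ih =>
      obtain ⟨φ, hφ⟩ := ih
      exact ⟨linkIso .refl φ rfl hφ, rfl⟩
  | refl p => exact .refl _ _
  | symm p q _ ih => exact ih.symm
  | trans p q r _ _ ih ih' => exact ih.trans ih'

/-- Every neighbour of the root is the root of a branch. -/
lemma exists_graft_of_adj_root (p : PlaneTree) {w : Vert p} (h : p.graph.Adj p.root w) :
    ∃ s t, mk (graft s t) = mk p ∧
      ∃ φ : p.graph ≃g (graft s t).graph, φ p.root = .inl s.root ∧ φ w = .inr t.root := by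
  induction p with
  | leaf => exact absurd h id
  | graft a b ha _ =>
    rcases w with w | w
    · obtain ⟨s, t, e, φ, h1, h2⟩ := ha h
      refine ⟨graft s b, t, ?_, ?_⟩
      · rw [mk_graft, mk_graft, graft_right_comm, ← mk_graft, e, mk_graft]
      · let L := linkRightComm (G := s.graph) (r := s.root) (H := t.graph) (q := t.root)
          (K := b.graph) (p := b.root)
        exact ⟨(linkIso φ .refl h1 rfl).trans L, congrArg (fun x => L (.inl x)) h1,
          congrArg (fun x => L (.inl x)) h2⟩
    · obtain ⟨-, rfl⟩ := h
      exact ⟨a, b, rfl, .refl, rfl, rfl⟩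

/-- Plane trees whose graphs are isomorphic as rooted graphs represent the same rooted tree. -/
theorem mk_eq_of_riso {p q : PlaneTree} (h : RIso p.graph p.root q.graph q.root) :
    mk p = mk q := by
  induction p generalizing q with
  | leaf =>
    have h1 : size (mk q) = 1 := by
      obtain ⟨φ, -⟩ := h
      rw [← (finite_vert_and_card q).2, ← Nat.card_congr φ.toEquiv, (finite_vert_and_card leaf).2]
      rfl
    exact (size_eq_one_iff.1 h1).symm
  | graft s t hs ht =>
    obtain ⟨φ, h⟩ := h
    have e : q.graph.Adj q.root (φ (.inr t.root)) := by
      rw [← h]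
      exact φ.map_adj_iff.2 ⟨rfl, rfl⟩
    obtain ⟨s', t', e, ψ, h1, h2⟩ := exists_graft_of_adj_root q e
    obtain ⟨r1, r2⟩ := riso_of_link (spans_graph s) (spans_graph t) (spans_graph s')
      (spans_graph t') (φ.trans ψ) ((congrArg ψ h).trans h1) h2
    rw [← e, mk_graft, mk_graft, hs r1, ht r2]

/-- Choosing another vertex as the root does not change the tree without a root. -/
lemma exists_root_at (p : PlaneTree) (v : Vert p) :
    ∃ q, free (mk q) = free (mk p) ∧ RIso p.graph v q.graph q.root := by
  refine spans_graph p (fun v => ∃ q, free (mk q) = free (mk p) ∧ RIso p.graph v q.graph q.root)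
    ⟨p, rfl, .refl _ _⟩ ?_ v
  rintro v w e ⟨q, hq, φ, h⟩
  have e' : q.graph.Adj q.root (φ w) := by
    rw [← h]
    exact φ.map_adj_iff.2 e
  obtain ⟨s, t, h1, ψ, h2, h3⟩ := exists_graft_of_adj_root q e'
  let L := linkComm (G := s.graph) (r := s.root) (H := t.graph) (q := t.root)
  refine ⟨graft t s, ?_, (φ.trans ψ).trans L, ?_⟩
  · rw [← hq, ← h1, mk_graft, mk_graft, free_graft_comm]
  · exact congrArg L h3

/-- Two plane trees represent the same tree without a root if and only if their graphs are
isomorphic. -/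
theorem free_mk_eq_iff {p q : PlaneTree} :
    free (mk p) = free (mk q) ↔ Nonempty (p.graph ≃g q.graph) := by
  constructor
  · intro h
    refine mem_of_free_eq
      (S := {x | ∀ q, mk q = x → Nonempty (p.graph ≃g q.graph)}) ?_ h ?_ q rfl
    · rintro _ _ ⟨s, t, rfl, rfl⟩ hx q hq
      obtain ⟨s, rfl⟩ := exists_mk s
      obtain ⟨t, rfl⟩ := exists_mk t
      obtain ⟨φ⟩ := hx (.graft s t) rfl
      obtain ⟨ψ, -⟩ := riso_of_mk_eq (p := .graft t s) (q := q) hq.symm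
      exact ⟨(φ.trans linkComm).trans ψ⟩
    · intro q hq
      obtain ⟨φ, -⟩ := riso_of_mk_eq hq.symm
      exact ⟨φ⟩
  · rintro ⟨φ⟩
    obtain ⟨q', h, hq'⟩ := exists_root_at q (φ p.root)
    have : RIso p.graph p.root q'.graph q'.root := RIso.trans ⟨φ, rfl⟩ hq'
    rw [mk_eq_of_riso this, h]

/-! ### Leaves of plane trees -/

/-- The leaves of a plane tree other than the root. -/
def leaves : (p : PlaneTree) → Multiset (Vert p)
  | leaf => 0
  | graft s leaf => s.leaves.map .inl + {.inr ()}
  | graft s (graft a b) => s.leaves.map .inl + (graft a b).leaves.map .inr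

/-- The plane tree obtained by deleting one of the `leaves`; for other vertices, the value is
irrelevant. -/
def delV : (p : PlaneTree) → Vert p → PlaneTree
  | leaf, _ => leaf
  | graft s leaf, .inl v => graft (s.delV v) leaf
  | graft s leaf, .inr _ => s
  | graft s (graft a b), .inl v => graft (s.delV v) (graft a b)
  | graft s (graft a b), .inr v => graft s ((graft a b).delV v)

lemma map_delV_leaves (p : PlaneTree) : p.leaves.map (fun v => mk (p.delV v)) = del (mk p) := by
  induction p with
  | leaf => rfl
  | graft s t hs ht =>
    cases t with
    | leaf =>
      rw [mk_graft, mk_leaf, del_graft_leaf, ← hs, leaves]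
      simp [Multiset.map_map, Function.comp_def, delV]
    | graft a b =>
      have hne : mk (graft a b) ≠ UTree.leaf := graft_ne_leaf (mk a) (mk b)
      rw [mk_graft, del_graft_of_ne _ hne,
        ← hs, ← ht, leaves]
      simp [Multiset.map_map, Function.comp_def, delV]

lemma mem_leaves_graft_leaf_inl {s : PlaneTree} {v : Vert s} :
    (.inl v : Vert (graft s leaf)) ∈ (graft s leaf).leaves ↔ v ∈ s.leaves := by
  rw [leaves, Multiset.mem_add, Multiset.mem_map]
  constructor
  · rintro (⟨w, hw, h⟩ | h)
    · rwa [← Sum.inl_injective h]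
    · exact absurd (Multiset.mem_singleton.1 h) Sum.inl_ne_inr
  · exact fun h => .inl ⟨v, h, rfl⟩

lemma mem_leaves_graft_leaf_inr {s : PlaneTree} {v : Vert leaf} :
    (.inr v : Vert (graft s leaf)) ∈ (graft s leaf).leaves := by
  rw [leaves, Multiset.mem_add]
  exact .inr (Multiset.mem_singleton.2 rfl)

lemma mem_leaves_graft_graft_inl {s a b : PlaneTree} {v : Vert s} :
    (.inl v : Vert (graft s (graft a b))) ∈ (graft s (graft a b)).leaves ↔ v ∈ s.leaves := by
  rw [leaves, Multiset.mem_add, Multiset.mem_map, Multiset.mem_map]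
  constructor
  · rintro (⟨w, hw, h⟩ | ⟨w, hw, h⟩)
    · rwa [← Sum.inl_injective h]
    · exact absurd h.symm Sum.inl_ne_inr
  · exact fun h => .inl ⟨v, h, rfl⟩

lemma mem_leaves_graft_graft_inr {s a b : PlaneTree} {v : Vert (graft a b)} :
    (.inr v : Vert (graft s (graft a b))) ∈ (graft s (graft a b)).leaves ↔
      v ∈ (graft a b).leaves := by
  rw [leaves, Multiset.mem_add, Multiset.mem_map, Multiset.mem_map]
  constructor
  · rintro (⟨w, hw, h⟩ | ⟨w, hw, h⟩)
    · exact absurd h Sum.inl_ne_inr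
    · rwa [← Sum.inr_injective h]
  · exact fun h => .inr ⟨v, h, rfl⟩

lemma nodup_leaves (p : PlaneTree) : p.leaves.Nodup := by
  induction p with
  | leaf => exact Multiset.nodup_zero
  | graft s t hs ht =>
    cases t with
    | leaf =>
      rw [leaves, Multiset.nodup_add]
      refine ⟨hs.map Sum.inl_injective, Multiset.nodup_singleton _, ?_⟩
      rw [Multiset.disjoint_singleton, Multiset.mem_map]
      rintro ⟨w, -, h⟩
      exact Sum.inl_ne_inr h
    | graft a b =>
      rw [leaves, Multiset.nodup_add]
      refine ⟨hs.map Sum.inl_injective, ht.map Sum.inr_injective, ?_⟩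
      rw [Multiset.disjoint_left]
      intro v hv hv'
      obtain ⟨w, -, rfl⟩ := Multiset.mem_map.1 hv
      obtain ⟨w', -, h⟩ := Multiset.mem_map.1 hv'
      exact Sum.inr_ne_inl h

lemma root_notMem_leaves (p : PlaneTree) : p.root ∉ p.leaves := by
  induction p with
  | leaf => exact Multiset.notMem_zero _
  | graft s t hs ht =>
    cases t with
    | leaf => exact fun h => hs (mem_leaves_graft_leaf_inl.1 h)
    | graft a b => exact fun h => hs (mem_leaves_graft_graft_inl.1 h)

lemma mem_leaves_graft_inl {s t : PlaneTree} {v : Vert s} :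
    (.inl v : Vert (graft s t)) ∈ (graft s t).leaves ↔ v ∈ s.leaves := by
  cases t with
  | leaf => exact mem_leaves_graft_leaf_inl
  | graft a b => exact mem_leaves_graft_graft_inl

lemma existsUnique_link_inl {V W : Type*} {G : SimpleGraph V} {r : V} {H : SimpleGraph W} {q : W}
    {v : V} (hv : v ≠ r) : (∃! w, (link G r H q).Adj (.inl v) w) ↔ ∃! w, G.Adj v w := by
  constructor
  · rintro ⟨w | w, h, hw⟩
    · exact ⟨w, h, fun w' h' => Sum.inl_injective (hw (.inl w') h')⟩
    · exact absurd h.1 hv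
  · rintro ⟨w, h, hw⟩
    refine ⟨.inl w, h, ?_⟩
    rintro (w' | w') h'
    · exact congrArg Sum.inl (hw w' h')
    · exact absurd h'.1 hv

lemma existsUnique_link_inr {V W : Type*} {G : SimpleGraph V} {r : V} {H : SimpleGraph W} {q : W}
    {v : W} (hv : v ≠ q) : (∃! w, (link G r H q).Adj (.inr v) w) ↔ ∃! w, H.Adj v w := by
  constructor
  · rintro ⟨w | w, h, hw⟩
    · exact absurd h.2 hv
    · exact ⟨w, h, fun w' h' => Sum.inr_injective (hw (.inr w') h')⟩
  · rintro ⟨w, h, hw⟩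
    refine ⟨.inr w, h, ?_⟩
    rintro (w' | w') h'
    · exact absurd h'.2 hv
    · exact congrArg Sum.inr (hw w' h')

/-- The list of leaves consists of the vertices of degree one other than the root. -/
lemma mem_leaves_iff (p : PlaneTree) {v : Vert p} (hv : v ≠ p.root) :
    v ∈ p.leaves ↔ ∃! w, p.graph.Adj v w := by
  induction p with
  | leaf => exact absurd (Subsingleton.elim _ _) hv
  | graft s t hs ht =>
    rcases v with v | v
    · have hv' : v ≠ s.root := fun h => hv (congrArg Sum.inl h)
      exact mem_leaves_graft_inl.trans ((hs hv').trans (existsUnique_link_inl hv').symm)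
    · cases t with
      | leaf =>
        refine iff_of_true mem_leaves_graft_leaf_inr ⟨.inl s.root, ⟨rfl, rfl⟩, ?_⟩
        rintro (w | w) h
        · exact congrArg Sum.inl h.1
        · exact absurd h id
      | graft a b =>
        by_cases hv' : v = (graft a b).root
        · subst hv'
          refine iff_of_false (fun h => root_notMem_leaves _ (mem_leaves_graft_graft_inr.1 h)) ?_
          intro h
          -- the root of the branch is adjacent to the root of `s` and to one of its children
          have := h.unique (y₁ := .inl s.root) (y₂ := .inr (.inr b.root)) ⟨rfl, rfl⟩ ⟨rfl, rfl⟩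
          exact Sum.inl_ne_inr this
        · exact mem_leaves_graft_graft_inr.trans ((ht hv').trans (existsUnique_link_inr hv').symm)

/-- The root has degree one only if there is a single branch. -/
lemma eq_plant_of_existsUnique_adj_root {p : PlaneTree} (h : ∃! w, p.graph.Adj p.root w) :
    ∃ t, mk p = plant t := by
  obtain ⟨w, hw, huniq⟩ := h
  obtain ⟨s, t, e, φ, h1, h2⟩ := exists_graft_of_adj_root p hw
  refine ⟨mk t, ?_⟩
  rw [← e]
  cases s with
  | leaf => rfl
  | graft a b =>
    have h3 : p.graph.Adj p.root (φ.symm (.inl (.inr b.root))) := by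
      refine φ.map_adj_iff.1 ?_
      rw [h1, φ.apply_symm_apply]
      exact ⟨rfl, rfl⟩
    have h4 := congrArg φ (huniq _ h3)
    rw [φ.apply_symm_apply, h2] at h4
    exact absurd h4 Sum.inl_ne_inr

lemma exists_embedding_delV (p : PlaneTree) {v : Vert p} (hv : v ∈ p.leaves) :
    ∃ g : (p.delV v).graph ↪g p.graph, Set.range g = {v}ᶜ ∧ g (p.delV v).root = p.root := by
  have left : ∀ (s t : PlaneTree) (v : Vert s),
      (∃ g : (s.delV v).graph ↪g s.graph, Set.range g = {v}ᶜ ∧ g (s.delV v).root = s.root) →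
      ∃ g : (graft (s.delV v) t).graph ↪g (graft s t).graph,
        Set.range g = {.inl v}ᶜ ∧ g (graft (s.delV v) t).root = (graft s t).root := by
    rintro s t v ⟨g, h1, h2⟩
    refine ⟨linkEmbedding g .refl h2 rfl, ?_, congrArg Sum.inl h2⟩
    ext x
    change (∃ y, Sum.map g id y = x) ↔ _
    rcases x with x | x
    · have := Set.ext_iff.1 h1 x
      simpa using this
    · simp
  induction p with
  | leaf => exact absurd hv (Multiset.notMem_zero _)
  | graft s t hs ht =>
    cases t with
    | leaf =>
      rcases v with v | v
      · exact left s leaf v (hs (mem_leaves_graft_inl.1 hv))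
      · refine ⟨linkInl, ?_, rfl⟩
        refine (show Set.range (Sum.inl : Vert s → Vert s ⊕ Unit) = _ from ?_)
        ext (x | x)
        · simp
        · simp
    | graft a b =>
      rcases v with v | v
      · exact left s (graft a b) v (hs (mem_leaves_graft_inl.1 hv))
      · obtain ⟨g, h1, h2⟩ := ht (mem_leaves_graft_graft_inr.1 hv)
        refine ⟨linkEmbedding .refl g rfl h2, ?_, rfl⟩
        ext x
        change (∃ y, Sum.map id g y = x) ↔ _
        rcases x with x | x
        · simp
        · have := Set.ext_iff.1 h1 x
          simpa using this

/-- The graph of `p.delV v` is the graph of `p` with the leaf `v` deleted. -/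
lemma nonempty_iso_delV (p : PlaneTree) {v : Vert p} (hv : v ∈ p.leaves) :
    Nonempty ((p.delV v).graph ≃g p.graph.induce {v}ᶜ) := by
  obtain ⟨g, h, -⟩ := exists_embedding_delV p hv
  rw [← h]
  exact ⟨g.isoInduceRange⟩

end PlaneTree

/-! ### Every finite tree is the graph of a plane tree -/

section Realize

open UTree PlaneTree

variable {V : Type*} {G : SimpleGraph V} {r u : V}

/-- Deleting the edge between `r` and `u` separates a tree into the part that contains `r` and the
part that contains `u`. -/
lemma SimpleGraph.IsTree.reachable_or (hG : G.IsTree) (v : V) :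
    (G.deleteEdges {s(r, u)}).Reachable r v ∨ (G.deleteEdges {s(r, u)}).Reachable u v := by
  have h := hG.connected.preconnected r v
  rw [SimpleGraph.reachable_iff_reflTransGen] at h
  induction h with
  | refl => exact .inl .rfl
  | @tail v w _ e ih =>
    by_cases h : s(v, w) = s(r, u)
    · rcases Sym2.eq_iff.1 h with ⟨-, rfl⟩ | ⟨-, rfl⟩
      · exact .inr .rfl
      · exact .inl .rfl
    · have e' : (G.deleteEdges {s(r, u)}).Adj v w :=
        SimpleGraph.deleteEdges_adj.2 ⟨e, by simpa using h⟩
      exact ih.imp (fun h => h.trans e'.reachable) fun h => h.trans e'.reachable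

lemma SimpleGraph.connected_induce_of_reachable {G' : SimpleGraph V} (hle : G' ≤ G) {S : Set V}
    (hr : r ∈ S) (hS : ∀ v, v ∈ S ↔ G'.Reachable r v) : (G.induce S).Connected := by
  have key : ∀ v, G'.Reachable r v → ∃ hv : v ∈ S, (G.induce S).Reachable ⟨r, hr⟩ ⟨v, hv⟩ := by
    intro v h
    rw [SimpleGraph.reachable_iff_reflTransGen] at h
    induction h with
    | refl => exact ⟨hr, .rfl⟩
    | @tail v w h e ih =>
      obtain ⟨hv, ih⟩ := ih
      have hw : w ∈ S := (hS w).2 (((hS v).1 hv).trans e.reachable)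
      have e' : (G.induce S).Adj ⟨v, hv⟩ ⟨w, hw⟩ := hle e
      exact ⟨hw, ih.trans e'.reachable⟩
  rw [SimpleGraph.connected_iff_exists_forall_reachable]
  refine ⟨⟨r, hr⟩, fun v => ?_⟩
  obtain ⟨_, h⟩ := key v ((hS v).1 v.2)
  exact h

/-- A tree splits at each of its edges into two linked trees. -/
lemma SimpleGraph.IsTree.exists_link (hG : G.IsTree) (h : G.Adj r u) :
    ∃ (S : Set V) (hr : r ∈ S) (hu : u ∈ Sᶜ), (G.induce S).IsTree ∧ (G.induce Sᶜ).IsTree ∧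
      RIso (link (G.induce S) ⟨r, hr⟩ (G.induce Sᶜ) ⟨u, hu⟩) (.inl ⟨r, hr⟩) G r := by
  classical
  set G' := G.deleteEdges {s(r, u)} with hG'
  have hbridge : ¬ G'.Reachable r u :=
    SimpleGraph.isBridge_iff.1 (SimpleGraph.isAcyclic_iff_forall_isBridge.1 hG.isAcyclic h)
  set S : Set V := {v | G'.Reachable r v} with hS
  have hr : r ∈ S := SimpleGraph.Reachable.rfl
  have hu : u ∈ Sᶜ := hbridge
  have hSc : ∀ v, v ∈ Sᶜ ↔ G'.Reachable u v := by
    intro v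
    constructor
    · intro hv
      exact (hG.reachable_or v).resolve_left hv
    · intro hv hv'
      exact hbridge (SimpleGraph.Reachable.trans hv' hv.symm)
  have hle : G' ≤ G := SimpleGraph.deleteEdges_le _
  refine ⟨S, hr, hu, ⟨SimpleGraph.connected_induce_of_reachable hle hr fun v => .rfl,
    hG.isAcyclic.induce S⟩, ⟨SimpleGraph.connected_induce_of_reachable hle hu hSc,
    hG.isAcyclic.induce Sᶜ⟩, ?_⟩
  have cross : ∀ a ∈ S, ∀ b ∈ Sᶜ, (G.Adj a b ↔ a = r ∧ b = u) := by
    intro a ha b hb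
    constructor
    · intro e
      by_cases h' : s(a, b) = s(r, u)
      · rcases Sym2.eq_iff.1 h' with h' | ⟨rfl, rfl⟩
        · exact h'
        · exact absurd hr hb
      · have e' : G'.Adj a b := SimpleGraph.deleteEdges_adj.2 ⟨e, by simpa using h'⟩
        exact absurd (SimpleGraph.Reachable.trans ha e'.reachable) hb
    · rintro ⟨rfl, rfl⟩
      exact h
  refine ⟨⟨Equiv.Set.sumCompl S, fun {a b} => ?_⟩, ?_⟩
  · rcases a with a | a <;> rcases b with b | b
    · simp
    · simp [cross a a.2 b b.2, Subtype.ext_iff]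
    · simp [G.adj_comm a, cross b b.2 a a.2, Subtype.ext_iff]
    · simp
  · exact Equiv.Set.sumCompl_apply_inl S ⟨r, hr⟩

/-- Every finite tree with a distinguished vertex is the graph of a plane tree. -/
theorem exists_planeTree {V : Type*} [Finite V] {G : SimpleGraph V} (hG : G.IsTree) (r : V) :
    ∃ p : PlaneTree, RIso p.graph p.root G r := by
  induction hn : Nat.card V using Nat.strong_induction_on generalizing V with
  | _ n ih =>
  by_cases h : ∃ u, G.Adj r u
  · obtain ⟨u, h⟩ := h
    obtain ⟨S, hr, hu, h1, h2, h3⟩ := hG.exists_link h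
    have hlt : ∀ (T : Set V) (v : V), v ∉ T → Nat.card T < n := fun T v hv => by
      rw [← hn, ← Nat.card_univ (α := V), Nat.card_coe_set_eq, Nat.card_coe_set_eq]
      exact Set.ncard_lt_ncard ⟨Set.subset_univ _, fun h => hv (h (Set.mem_univ v))⟩
    obtain ⟨p, φ, hp⟩ := ih _ (hlt S u hu) h1 ⟨r, hr⟩ rfl
    obtain ⟨q, ψ, hq⟩ := ih _ (hlt Sᶜ r (fun h => h hr)) h2 ⟨u, hu⟩ rfl
    exact ⟨.graft p q, RIso.trans ⟨linkIso φ ψ hp hq, congrArg Sum.inl hp⟩ h3⟩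
  · have hsub : ∀ v, v = r := by
      intro v
      have := hG.connected.preconnected r v
      rw [SimpleGraph.reachable_iff_reflTransGen] at this
      rcases this.cases_head with h' | ⟨w, h', -⟩
      · exact h'.symm
      · exact absurd ⟨w, h'⟩ h
    refine ⟨.leaf, ⟨⟨fun _ => r, fun _ => (), fun _ => rfl, fun v => (hsub v).symm⟩, ?_⟩, rfl⟩
    intro a b
    exact iff_of_false (G.irrefl) id

/-- Every finite tree is the graph of a plane tree whose root is a centroid. -/
theorem exists_centroid_planeTree {V : Type*} [Finite V] {G : SimpleGraph V} (hG : G.IsTree) :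
    ∃ p : PlaneTree, Centroid (mk p) ∧ Nonempty (p.graph ≃g G) := by
  obtain ⟨r⟩ := hG.connected.nonempty
  obtain ⟨p, φ, -⟩ := exists_planeTree hG r
  obtain ⟨y, hy, h⟩ := exists_centroid (mk p)
  obtain ⟨q, rfl⟩ := exists_mk y
  obtain ⟨ψ⟩ := free_mk_eq_iff.1 h
  exact ⟨q, hy, ⟨ψ.trans φ⟩⟩

end Realize

/-! ### Hypomorphic graphs -/

namespace GraphReconstruction

open UTree PlaneTree

/-- A bijection between the vertices of two graphs for which corresponding cards are isomorphic. -/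
def IsHypomorphism {V W : Type*} (G : SimpleGraph V) (H : SimpleGraph W) (σ : V ≃ W) : Prop :=
  ∀ v, Nonempty (G.induce {v}ᶜ ≃g H.induce {σ v}ᶜ)

lemma exists_equiv_of_map_univ_eq {V W X : Type*} [Fintype V] [Fintype W] {f : V → X} {g : W → X}
    (h : (Finset.univ : Finset V).val.map f = (Finset.univ : Finset W).val.map g) :
    ∃ σ : V ≃ W, ∀ v, f v = g (σ v) := by
  classical
  have key : ∀ c, Nonempty ({v // f v = c} ≃ {w // g w = c}) := by
    intro c
    have := congrArg (Multiset.count c) h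
    rw [Multiset.count_map, Multiset.count_map] at this
    refine ⟨Fintype.equivOfCardEq ?_⟩
    rw [Fintype.card_subtype, Fintype.card_subtype]
    simpa [Finset.card_def, eq_comm] using this
  exact ⟨Equiv.ofFiberEquiv fun c => (key c).some,
    fun v => (Equiv.ofFiberEquiv_map (fun c => (key c).some) v).symm⟩

lemma exists_isHypomorphism.{u} {V W : Type u} [Fintype V] [Fintype W] {G : SimpleGraph V}
    {H : SimpleGraph W} (h : deck G = deck H) : ∃ σ : V ≃ W, IsHypomorphism G H σ := by
  obtain ⟨σ, hσ⟩ := exists_equiv_of_map_univ_eq h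
  exact ⟨σ, fun v => Quotient.exact (hσ v)⟩

section

variable {V W : Type*} {G : SimpleGraph V} {H : SimpleGraph W} {σ : V ≃ W}

open Finset in
/-- The edges of a graph can be counted on its cards. -/
lemma sum_card_edgeFinset_induce [Fintype V] [DecidableEq V] [DecidableRel G.Adj] :
    ∑ v, #(G.induce {v}ᶜ).edgeFinset + 2 * #G.edgeFinset = Fintype.card V * #G.edgeFinset := by
  rw [← G.sum_degrees_eq_twice_card_edges, ← Finset.sum_add_distrib]
  rw [Finset.sum_congr rfl fun v _ => ?_, Finset.sum_const, smul_eq_mul, Finset.card_univ]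
  have := G.card_edgeFinset_deleteIncidenceSet v
  have h := G.card_edgeFinset_induce_compl_singleton v
  have := G.degree_le_card_edgeFinset v
  omega

open Finset in
lemma IsHypomorphism.card_edgeFinset_induce_eq [Fintype V] [DecidableEq V] [DecidableRel G.Adj]
    [Fintype W] [DecidableEq W] [DecidableRel H.Adj] (hσ : IsHypomorphism G H σ) (v : V) :
    #(G.induce {v}ᶜ).edgeFinset = #(H.induce {σ v}ᶜ).edgeFinset := by
  obtain ⟨φ⟩ := hσ v
  exact φ.card_edgeFinset_eq

open Finset in
lemma IsHypomorphism.card_edgeFinset_eq [Fintype V] [DecidableEq V] [DecidableRel G.Adj]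
    [Fintype W] [DecidableEq W] [DecidableRel H.Adj] (hσ : IsHypomorphism G H σ)
    (h3 : 3 ≤ Fintype.card V) : #G.edgeFinset = #H.edgeFinset := by
  have hG := sum_card_edgeFinset_induce (G := G)
  have hH := sum_card_edgeFinset_induce (G := H)
  rw [← Fintype.card_congr σ, ← σ.sum_comp] at hH
  rw [Finset.sum_congr rfl fun v _ => hσ.card_edgeFinset_induce_eq v] at hG
  obtain ⟨k, hk⟩ := Nat.exists_eq_add_of_le h3
  rw [hk] at hG hH
  refine Nat.eq_of_mul_eq_mul_left (Nat.succ_pos k) ?_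
  simp only [Nat.succ_eq_add_one]
  linarith

lemma IsHypomorphism.degree_eq [Fintype V] [DecidableEq V] [DecidableRel G.Adj]
    [Fintype W] [DecidableEq W] [DecidableRel H.Adj] (hσ : IsHypomorphism G H σ)
    (h3 : 3 ≤ Fintype.card V) (v : V) : G.degree v = H.degree (σ v) := by
  have h1 := hσ.card_edgeFinset_eq h3
  have h2 := hσ.card_edgeFinset_induce_eq v
  rw [G.card_edgeFinset_induce_compl_singleton, H.card_edgeFinset_induce_compl_singleton,
    G.card_edgeFinset_deleteIncidenceSet, H.card_edgeFinset_deleteIncidenceSet] at h2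
  have := G.degree_le_card_edgeFinset v
  have := H.degree_le_card_edgeFinset (σ v)
  omega

lemma IsHypomorphism.existsUnique_adj_iff [Finite V] (hσ : IsHypomorphism G H σ)
    (h3 : 3 ≤ Nat.card V) (v : V) : (∃! w, G.Adj v w) ↔ ∃! w, H.Adj (σ v) w := by
  classical
  have := Fintype.ofFinite V
  have := Fintype.ofEquiv V σ
  rw [Nat.card_eq_fintype_card] at h3
  rw [← SimpleGraph.degree_eq_one_iff_existsUnique_adj, hσ.degree_eq h3,
    SimpleGraph.degree_eq_one_iff_existsUnique_adj]

/-- A graph with at least three vertices is connected if it has two connected cards. -/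
lemma connected_of_induce_connected [Fintype V] (h3 : 3 ≤ Fintype.card V) {a b : V} (hab : a ≠ b)
    (ha : (G.induce {a}ᶜ).Connected) (hb : (G.induce {b}ᶜ).Connected) : G.Connected := by
  classical
  obtain ⟨c, hc⟩ : ∃ c, c ∉ ({a, b} : Finset V) := by
    by_contra! h
    have := Finset.card_le_card (fun v _ => h v : (Finset.univ : Finset V) ⊆ {a, b})
    rw [Finset.card_univ, Finset.card_pair hab] at this
    omega
  simp only [Finset.mem_insert, Finset.mem_singleton, not_or] at hc
  rw [SimpleGraph.connected_iff_exists_forall_reachable]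
  have key : ∀ {d v : V}, (G.induce {d}ᶜ).Connected → c ≠ d → v ≠ d → G.Reachable c v :=
    fun {d v} hd hc hv => (hd.preconnected ⟨c, hc⟩ ⟨v, hv⟩).map
      (SimpleGraph.Embedding.induce _).toHom
  refine ⟨c, fun v => ?_⟩
  by_cases h : v = a
  · exact key hb hc.2 (h ▸ hab)
  · exact key ha hc.1 h

lemma IsHypomorphism.isTree [Fintype V] [Fintype W] (hσ : IsHypomorphism G H σ)
    (h3 : 3 ≤ Fintype.card V) (hG : G.IsTree) : H.IsTree := by
  classical
  have : Nontrivial V := Fintype.one_lt_card_iff_nontrivial.1 (by omega)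
  obtain ⟨a, b, hab, ha, hb⟩ := hG.exists_ne_and_degree_eq_one
  have conn : ∀ v, G.degree v = 1 → (H.induce {σ v}ᶜ).Connected := fun v hv => by
    obtain ⟨φ⟩ := hσ v
    exact φ.connected_iff.1 (hG.connected.induce_compl_singleton_of_degree_eq_one hv)
  refine SimpleGraph.isTree_iff_connected_and_card.2
    ⟨connected_of_induce_connected (Fintype.card_congr σ ▸ h3) (σ.injective.ne hab) (conn a ha)
      (conn b hb), ?_⟩
  have h1 := (SimpleGraph.isTree_iff_connected_and_card.1 hG).2
  have h2 := hσ.card_edgeFinset_eq h3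
  rw [SimpleGraph.edgeFinset_card, SimpleGraph.edgeFinset_card] at h2
  rw [← Nat.card_congr σ, ← h1, Nat.card_eq_fintype_card, Nat.card_eq_fintype_card, h2]

/-- The isomorphism between cards that is induced by an isomorphism of graphs. -/
def isoCard (φ : G ≃g H) (v : V) : G.induce {v}ᶜ ≃g H.induce {φ v}ᶜ :=
  φ.induce (φ.toEquiv.bijOn fun w => by simp)

lemma IsHypomorphism.congr {V' W' : Type*} {G' : SimpleGraph V'} {H' : SimpleGraph W'}
    (hσ : IsHypomorphism G H σ) (φ : G' ≃g G) (ψ : H' ≃g H) :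
    IsHypomorphism G' H' ((φ.toEquiv.trans σ).trans ψ.toEquiv.symm) := by
  intro v
  obtain ⟨f⟩ := hσ (φ v)
  have g := isoCard ψ (ψ.symm (σ (φ v)))
  rw [ψ.apply_symm_apply] at g
  exact ⟨((isoCard φ v).trans f).trans g.symm⟩

end

/-- Plane trees with a centroid as root represent the same tree without a root if their graphs are
hypomorphic: since a centroid is not a leaf, the cards at the vertices of degree one are the
leaf-deleted subtrees. -/
lemma free_mk_eq_of_isHypomorphism {p q : PlaneTree} (hp : Centroid (mk p)) (hq : Centroid (mk q))
    {σ : Vert p ≃ Vert q} (hσ : IsHypomorphism p.graph q.graph σ) (h3 : 3 ≤ size (mk p)) :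
    free (mk p) = free (mk q) := by
  have hs : size (mk p) = size (mk q) := by
    rw [← (finite_vert_and_card p).2, ← (finite_vert_and_card q).2, Nat.card_congr σ]
  refine free_eq_of_map_free_del h3 hp hq hs ?_
  have hroot : ∀ {p : PlaneTree}, Centroid (mk p) → 3 ≤ size (mk p) →
      ¬ ∃! w, p.graph.Adj p.root w := by
    intro p hp h3 h
    obtain ⟨t, ht⟩ := eq_plant_of_existsUnique_adj_root h
    have := hp t (by simp [ht])
    simp only [ht, size_graft, size_leaf] at this h3
    omega
  have mem : ∀ {p : PlaneTree}, Centroid (mk p) → 3 ≤ size (mk p) → ∀ v,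
      v ∈ p.leaves ↔ ∃! w, p.graph.Adj v w := by
    intro p hp h3 v
    by_cases hv : v = p.root
    · rw [hv]
      exact iff_of_false (root_notMem_leaves p) (hroot hp h3)
    · exact mem_leaves_iff p hv
  have hleaf : ∀ v, v ∈ p.leaves ↔ σ v ∈ q.leaves := fun v => by
    rw [mem hp h3, mem hq (hs ▸ h3),
      hσ.existsUnique_adj_iff ((finite_vert_and_card p).2.symm ▸ h3)]
  have hleaves : q.leaves = p.leaves.map σ := by
    refine ((nodup_leaves q).ext ((nodup_leaves p).map σ.injective)).2 fun w => ?_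
    rw [Multiset.mem_map]
    constructor
    · exact fun hw => ⟨σ.symm w, (hleaf _).2 (by rwa [σ.apply_symm_apply]), σ.apply_symm_apply w⟩
    · rintro ⟨v, hv, rfl⟩
      exact (hleaf v).1 hv
  rw [← map_delV_leaves, ← map_delV_leaves, hleaves, Multiset.map_map, Multiset.map_map,
    Multiset.map_map]
  refine Multiset.map_congr rfl fun v hv => free_mk_eq_iff.2 ?_
  obtain ⟨φ⟩ := nonempty_iso_delV p hv
  obtain ⟨ψ⟩ := nonempty_iso_delV q ((hleaf v).1 hv)
  obtain ⟨f⟩ := hσ v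
  exact ⟨(φ.trans f).trans ψ.symm⟩

/-- Two trees with the same deck are isomorphic to plane trees with a centroid as root, to which the
reconstruction of such plane trees applies. -/
theorem reconstructible_of_isTree {V : Type*} [Fintype V] {T : SimpleGraph V} (hT : T.IsTree)
    (hcard : 3 ≤ Fintype.card V) : Reconstructible T := by
  intro W _ H hH
  obtain ⟨σ, hσ⟩ := exists_isHypomorphism hH.symm
  obtain ⟨p, hp, ⟨φ⟩⟩ := exists_centroid_planeTree hT
  obtain ⟨q, hq, ⟨ψ⟩⟩ := exists_centroid_planeTree (hσ.isTree hcard hT)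
  have h3 : 3 ≤ size (mk p) := by
    rwa [← (finite_vert_and_card p).2, Nat.card_congr φ.toEquiv, Nat.card_eq_fintype_card]
  obtain ⟨f⟩ := free_mk_eq_iff.1 (free_mk_eq_of_isHypomorphism hp hq (hσ.congr φ ψ) h3)
  exact ⟨(ψ.symm.trans f.symm).trans φ⟩

end GraphReconstruction

theorem mainTheorem1 {V : Type*} [Fintype V] (T : SimpleGraph V) (hT : T.IsTree)
    (hcard : 3 ≤ Fintype.card V) : GraphReconstruction.Reconstructible T :=
  GraphReconstruction.reconstructible_of_isTree hT hcard
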